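/- Let $\Bbbk$ be an algebraically closed field of characteristic $p>0$ and let $X\to\mathbb P^1$ be a Harbater–Katz–Gabber cover over $\Bbbk$ whose Galois group $G$ is a $p$-group: it is totally ramified at one point $P\in X$ and unramified outside $P$. Let $F$ be the function field of $X$, let $g=\dim_{\Bbbk} H^0(X,\Omega_X)$, and suppose that $F$ is obtained from $F^{G}=\Bbbk(f_0)=F_1$ by a tower $$F_1\subset F_2\subset\dots\subset F_{k+1}=F,\qquad F_{i+1}=F_i(f_i)\quad(1\le i\le k),$$ of the following kind. The lower ramification groups $G_j=G_j(P)$ have the jumps $b_1<\dots<b_k$, all prime to $p$, with $G_{b_i}=\mathrm{Gal}(F/F_i)$ and $G_{b_i+1}=\mathrm{Gal}(F/F_{i+1})$; $P$ is the only pole of each $f_i$; the pole order at $P$ of $f_0$ is $|G_0|=p^{n_1+\dots+n_k}$ and that of $f_i$, $i\ge1$, is $\bar m_i=p^{n_{i+1}+\dots+n_k}b_i$; and the irreducible polynomial of $f_i$ over $F_i$ is $$X^{p^{n_i}}+a^{(i)}_{n_i-1}X^{p^{n_i-1}}+\dots+a^{(i)}_0X-D_i,\qquad D_i=\sum_{\bar\lambda\in\Lambda_i}a^{(i)}_{\bar\lambda}f_{\bar\lambda}\in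 F_i,$$ with $n_i\ge1$ and coefficients $a^{(i)}_j,a^{(i)}_{\bar\lambda}\in\Bbbk$, almost all $a^{(i)}_{\bar\lambda}$ being zero. Here $f_u=f_0^{u_0}\cdots f_k^{u_k}$ for $u\in\mathbb N^{k+1}$, and $\Lambda_i$ is the set of all $\bar\lambda=(\ell_0,\dots,\ell_{i-1},0,\dots,0)\in\mathbb N^{k+1}$ with $\ell_\nu<p^{n_\nu}$ for $1\le\nu\le i-1$. Put $\|u\|=u_0|G_0|+\sum_{\nu=1}^k u_\nu\bar m_\nu$ and $\mathbf A=\{L\in\mathbb N^{k+1}:\|L\|\le 2g-2\}$. Let $\phi:\mathrm{Sym}\,H^0(X,\Omega_X)\to\bigoplus_{n\ge0}H^0(X,\Omega_X^{\otimes n})$ be the canonical map; the canonical ideal is $\ker\phi$. A representative of $f_u\,df_0^{\otimes2}$ is an element $\omega_u^{\otimes2}$ of degree $2$ of $\mathrm{Sym}\,H^0(X,\Omega_X)$ with $\phi(\omega_u^{\otimes 2})=f_u\,df_0^{\otimes2}$. Then $\omega_L:=f_L\,df_0$ is a holomorphic differential for each $L\in\mathbf A$, and for $L,K\in\mathbf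 A$ the product $\omega_L\omega_K$ is a representative of $f_{L+K}\,df_0^{\otimes2}$. Moreover, let $1\le i\le k$ and let $\bar v\in\mathbb N^{k+1}$; for $0\le\nu\le n_i$ let $\bar\gamma_{\bar v,i,\nu}$ be obtained from $\bar v$ by adding $p^{n_i-\nu}$ to the entry $v_i$, and put $\bar\beta_{\bar v,i,\bar\lambda}=\bar\lambda+\bar v$. Suppose that $\|\bar\gamma_{\bar v,i,0}\|\le4g-4$. Then: 1. each $u$ among the $\bar\gamma_{\bar v,i,\nu}$, $0\le\nu\le n_i$, and the $\bar\beta_{\bar v,i,\bar\lambda}$, where $\bar\lambda\in\Lambda_i$, $a^{(i)}_{\bar\lambda}\ne0$ and $\|\bar\lambda\|\le p^{n_i}\bar m_i$, satisfies $\|u\|\le4g-4$, and $f_u\,df_0^{\otimes2}$ is a holomorphic quadratic differential; 2. for every choice of representatives $\omega_u^{\otimes2}$ of the quadratic differentials $f_u\,df_0^{\otimes2}$ for these $u$, the element $$G_{\bar v,i}=\omega_{\bar\gamma_{\bar v,i,0}}^{\otimes2}+\sum_{\nu=1}^{n_i}a^{(i)}_{n_i-\nu}\,\omega_{\bar\gamma_{\bar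 v,i,\nu}}^{\otimes2}-\sum_{\bar\lambda\in\Lambda_i,\ \|\bar\lambda\|\le p^{n_i}\bar m_i}a^{(i)}_{\bar\lambda}\,\omega_{\bar\beta_{\bar v,i,\bar\lambda}}^{\otimes2}$$ is homogeneous of degree $2$ and lies in the canonical ideal. -/

import Mathlib

open scoped IntermediateField

noncomputable section

namespace HKG

section Curve

variable (𝕜 : Type*) {F : Type*} [Field 𝕜] [Field F] [Algebra 𝕜 F]

/-- The closed points of the complete nonsingular curve over the algebraically closed field `𝕜`
with function field `F` are the nontrivial valuation rings of `F` that contain `𝕜`. -/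
structure IsPlace (O : ValuationSubring F) : Prop where
  contains_constants : ∀ c : 𝕜, algebraMap 𝕜 F c ∈ O
  ne_top : O ≠ ⊤

/-- `t` generates the maximal ideal of the valuation ring `O`. -/
def IsUniformizer (O : ValuationSubring F) (t : O) : Prop :=
  IsLocalRing.maximalIdeal O = Ideal.span {t}

/-- `x` has a pole of order exactly `m` at `O` : `x * t ^ m` is a unit of `O` for some
uniformizer `t`. -/
def HasPoleOrder (O : ValuationSubring F) (x : F) (m : ℕ) : Prop :=
  ∃ t : O, IsUniformizer O t ∧ ∃ w : Oˣ, x * (t : F) ^ m = ((w : O) : F)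

/-- The `j`-th ramification group, in the lower numbering, of the place `O` of `F` over the
subfield `E` : the automorphisms that act trivially on `O / 𝔪 ^ (j + 1)`.
For `j = 0` this is the inertia group. -/
def ramificationGroup (E : Type*) [Field E] [Algebra E F] (O : ValuationSubring F) (j : ℕ) :
    Set (F ≃ₐ[E] F) :=
  {σ | ∀ x : O, ∃ y ∈ IsLocalRing.maximalIdeal O ^ (j + 1), σ (x : F) - (x : F) = ((y : O) : F)}

/-- A Harbater-Katz-Gabber cover with group a `p`-group: `F` is a finite Galois extension of the
rational function field `𝕜(x)` whose group is a `p`-group, totally ramified at the place `P`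
and unramified at all the other places (the residue fields are all equal to the algebraically
closed field `𝕜`, so that ramification is read off from the inertia groups). -/
structure IsHKGCover (p : ℕ) (x : F) (P : ValuationSubring F) : Prop where
  transcendental : Transcendental 𝕜 x
  finite : FiniteDimensional 𝕜⟮x⟯ F
  galois : IsGalois 𝕜⟮x⟯ F
  isPGroup : IsPGroup p (F ≃ₐ[𝕜⟮x⟯] F)
  place : IsPlace 𝕜 P
  totally_ramified : ramificationGroup 𝕜⟮x⟯ P 0 = Set.univ
  unramified : ∀ Q : ValuationSubring F, IsPlace 𝕜 Q → Q ≠ P → ramificationGroup 𝕜⟮x⟯ Q 0 = {1}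

variable (F)

/-- The algebra `⨁ₙ Ω^{⊗ n}` of meromorphic polydifferentials. The space `Ω` of meromorphic
differentials is one-dimensional over `F`, so that `Ω^{⊗ n}` is its `n`-th symmetric power. -/
abbrev PolyDiff : Type _ := SymmetricAlgebra F (Ω[F⁄𝕜])

variable {F} in
/-- The differential `dx`, as a polydifferential of degree one. -/
def dd (x : F) : PolyDiff 𝕜 F := SymmetricAlgebra.ι F (Ω[F⁄𝕜]) (KaehlerDifferential.D 𝕜 F x)

/-- `H⁰(X, Ω)` : the differentials that are regular at each place `O`, that is, that
belong to the `O`-module generated by the `dx` with `x ∈ O`. -/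
def holomorphicDifferentials : Submodule 𝕜 (Ω[F⁄𝕜]) :=
  ⨅ (O : ValuationSubring F) (_ : IsPlace 𝕜 O),
    Submodule.span 𝕜 {ω | ∃ a ∈ O, ∃ x ∈ O, ω = a • KaehlerDifferential.D 𝕜 F x}

/-- `H⁰(X, Ω^{⊗ 2})` : the quadratic differentials that are regular at each place `O`, that is,
that belong to the `O`-module generated by the `dx dy` with `x, y ∈ O`. -/
def holomorphicQuadraticDifferentials : Submodule 𝕜 (PolyDiff 𝕜 F) :=
  ⨅ (O : ValuationSubring F) (_ : IsPlace 𝕜 O),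
    Submodule.span 𝕜 {q | ∃ a ∈ O, ∃ x ∈ O, ∃ y ∈ O, q = a • (dd 𝕜 x * dd 𝕜 y)}

/-- The genus `g = dim H⁰(X, Ω)`. -/
def genus : ℕ := Module.finrank 𝕜 (holomorphicDifferentials 𝕜 F)

/-- `Sym H⁰(X, Ω)`. -/
abbrev SymH : Type _ := SymmetricAlgebra 𝕜 (holomorphicDifferentials 𝕜 F)

/-- The canonical map `φ` from `Sym H⁰(X, Ω)` to the polydifferentials, which multiplies
differentials. -/
def canonicalMap : SymH 𝕜 F →ₐ[𝕜] PolyDiff 𝕜 F :=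
  SymmetricAlgebra.lift
    (((SymmetricAlgebra.ι F (Ω[F⁄𝕜])).restrictScalars 𝕜).comp
      (holomorphicDifferentials 𝕜 F).subtype)

/-- The canonical ideal: the kernel of the canonical map. -/
def canonicalIdeal : Ideal (SymH 𝕜 F) := RingHom.ker (canonicalMap 𝕜 F)

/-- The homogeneous part of degree two of `Sym H⁰(X, Ω)`. -/
def Sym2H : Submodule 𝕜 (SymH 𝕜 F) :=
  LinearMap.range (SymmetricAlgebra.ι 𝕜 (holomorphicDifferentials 𝕜 F)) ^ 2

end Curve

/-- The monomial `f₀ ^ u₀ ⋯ f_k ^ u_k`. -/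
def monom {k : ℕ} {F : Type*} [Field F] (f : Fin (k + 1) → F) (u : Fin (k + 1) → ℕ) : F :=
  ∏ j, f j ^ u j

/-- The weights `|G₀| = p ^ (n₁ + ⋯ + n_k)` and `m̄ᵢ = p ^ (nᵢ₊₁ + ⋯ + n_k) * bᵢ`. A step
`1 ≤ i ≤ k` of the tower is an element of `Fin k`, and its generator `fᵢ` has the index `i.succ`
among the `k + 1` generators `f₀, …, f_k`. -/
def weight (p : ℕ) {k : ℕ} (n b : Fin k → ℕ) : Fin (k + 1) → ℕ :=
  Fin.cases (p ^ ∑ j, n j) fun i => p ^ (∑ j ∈ Finset.Ioi i, n j) * b i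

/-- `‖u‖ = u₀ |G₀| + ∑ᵢ uᵢ m̄ᵢ`. -/
def wnorm (p : ℕ) {k : ℕ} (n b : Fin k → ℕ) (u : Fin (k + 1) → ℕ) : ℕ :=
  ∑ j, u j * weight p n b j

/-- The exponents `(ℓ₀, …, ℓᵢ₋₁, 0, …, 0)` with `ℓ_ν < p ^ n_ν` for `1 ≤ ν ≤ i - 1`. -/
def reducedExponents (p : ℕ) {k : ℕ} (n : Fin k → ℕ) (i : Fin k) : Set (Fin (k + 1) → ℕ) :=
  {l | (∀ j, i.succ ≤ j → l j = 0) ∧ ∀ ν : Fin k, ν < i → l ν.succ < p ^ n ν}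

/-- The field `Fᵢ = 𝕜(f₀, …, fᵢ₋₁)`. -/
def stepField (𝕜 : Type*) {F : Type*} [Field 𝕜] [Field F] [Algebra 𝕜 F] {k : ℕ}
    (f : Fin (k + 1) → F) (i : Fin k) : IntermediateField 𝕜 F :=
  IntermediateField.adjoin 𝕜 (f '' {j | j < i.succ})

open Polynomial in
/-- The polynomial `X ^ (p ^ n) + ∑_{j < n} a_j X ^ (p ^ j) - D` with `D = ∑_λ d_λ f ^ λ`. -/
def stepPolynomial (p : ℕ) {𝕜 F : Type*} [Field 𝕜] [Field F] [Algebra 𝕜 F] {k : ℕ}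
    (f : Fin (k + 1) → F) (n : ℕ) (a : ℕ → 𝕜) (d : (Fin (k + 1) → ℕ) →₀ 𝕜) : F[X] :=
  X ^ p ^ n + ∑ j ∈ Finset.range n, C (algebraMap 𝕜 F (a j)) * X ^ p ^ j
    - C (∑ l ∈ d.support, algebraMap 𝕜 F (d l) * monom f l)

/-- A Harbater-Katz-Gabber cover with group a `p`-group, together with the tower
`𝕜(f₀) = F₁ ⊂ F₂ ⊂ ⋯ ⊂ F_{k+1} = F`, `Fᵢ₊₁ = Fᵢ(fᵢ)`, of the fixed fields of the ramification
groups, and the additive polynomial equations satisfied by its generators. -/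
structure Tower (p k : ℕ) (𝕜 F : Type*) [Field 𝕜] [Field F] [Algebra 𝕜 F] where
  /-- the ramified place -/
  P : ValuationSubring F
  /-- the generators `f₀, …, f_k` -/
  f : Fin (k + 1) → F
  /-- the step `i` has degree `p ^ n i` -/
  n : Fin k → ℕ
  /-- the jumps of the ramification filtration -/
  b : Fin k → ℕ
  /-- `a i j` is the coefficient of `X ^ (p ^ j)`, `0 ≤ j < n i`, in the equation of `fᵢ` -/
  a : Fin k → ℕ → 𝕜
  /-- `d i` is the family of the coefficients of `Dᵢ` as a polynomial in `f₀, …, fᵢ₋₁` -/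
  d : Fin k → ((Fin (k + 1) → ℕ) →₀ 𝕜)
  cover : IsHKGCover 𝕜 p (f 0) P
  generate : IntermediateField.adjoin 𝕜 (Set.range f) = ⊤
  n_pos : ∀ i, 0 < n i
  b_strictMono : StrictMono b
  b_coprime : ∀ i, Nat.Coprime (b i) p
  /-- `G_{bᵢ}` is the group of `F` over `Fᵢ = 𝕜(f₀, …, fᵢ₋₁)` -/
  jump : ∀ i, ramificationGroup 𝕜⟮f 0⟯ P (b i) = {σ | ∀ j, j < i.succ → σ (f j) = f j}
  /-- `G_{bᵢ + 1}` is the group of `F` over `Fᵢ₊₁` -/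
  jump_succ : ∀ i, ramificationGroup 𝕜⟮f 0⟯ P (b i + 1) = {σ | ∀ j, j ≤ i.succ → σ (f j) = f j}
  /-- `P` is the only pole of each generator -/
  regular : ∀ j (Q : ValuationSubring F), IsPlace 𝕜 Q → Q ≠ P → f j ∈ Q
  /-- `f₀` has a pole of order `|G₀|`, and `fᵢ` one of order `m̄ᵢ`, at `P` -/
  pole : ∀ j, HasPoleOrder P (f j) (weight p n b j)
  d_reduced : ∀ i, ∀ l ∈ (d i).support, l ∈ reducedExponents p n i
  /-- the irreducible polynomial of `fᵢ` over `Fᵢ` -/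
  equation : ∀ i, (minpoly (stepField 𝕜 f i) (f i.succ)).map (algebraMap (stepField 𝕜 f i) F) =
    stepPolynomial p f (n i) (a i) (d i)

namespace Tower

variable {p k : ℕ} {𝕜 F : Type*} [Field 𝕜] [Field F] [Algebra 𝕜 F] (T : Tower p k 𝕜 F)

/-- `‖u‖`. -/
def nrm (u : Fin (k + 1) → ℕ) : ℕ := wnorm p T.n T.b u

/-- The set `𝐀` of the exponents `L` with `‖L‖ ≤ 2 g - 2` (in `ℤ`). -/
def A : Set (Fin (k + 1) → ℕ) := {L | T.nrm L + 2 ≤ 2 * genus 𝕜 F}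

/-- The differential `f_L df₀`. -/
def diff (L : Fin (k + 1) → ℕ) : Ω[F⁄𝕜] :=
  monom T.f L • KaehlerDifferential.D 𝕜 F (T.f 0)

/-- The quadratic differential `f_u df₀^{⊗ 2}`. -/
def quadDiff (u : Fin (k + 1) → ℕ) : PolyDiff 𝕜 F := monom T.f u • dd 𝕜 (T.f 0) ^ 2

/-- `q` is an element of degree two of `Sym H⁰(X, Ω)` that represents the quadratic differential
`f_u df₀^{⊗ 2}`. -/
def Represents (u : Fin (k + 1) → ℕ) (q : SymH 𝕜 F) : Prop :=
  q ∈ Sym2H 𝕜 F ∧ canonicalMap 𝕜 F q = T.quadDiff u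

/-- `γ_{v,i,ν} = (v₀, …, vᵢ + p ^ (nᵢ - ν), …, v_k)`, for `0 ≤ ν ≤ nᵢ`. -/
def gamma (v : Fin (k + 1) → ℕ) (i : Fin k) (ν : ℕ) : Fin (k + 1) → ℕ :=
  v + Pi.single i.succ (p ^ (T.n i - ν))

/-- `β_{v,λ} = λ + v`. -/
def beta (v l : Fin (k + 1) → ℕ) : Fin (k + 1) → ℕ := l + v

/-- The exponents `λ ∈ Λᵢ` of the monomials of `Dᵢ` with `‖λ‖ ≤ p ^ nᵢ m̄ᵢ`. -/
def lambdas (i : Fin k) : Finset (Fin (k + 1) → ℕ) :=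
  (T.d i).support.filter fun l => T.nrm l ≤ p ^ T.n i * weight p T.n T.b i.succ

/-- The exponents of all the terms of `G_{v,i}`. -/
def terms (v : Fin (k + 1) → ℕ) (i : Fin k) : Set (Fin (k + 1) → ℕ) :=
  {u | (∃ ν ≤ T.n i, u = T.gamma v i ν) ∨ ∃ l ∈ T.lambdas i, u = beta v l}

/-- The element `G_{v,i}`, for a choice `W u` of a representative `ω_u^{⊗ 2}` of each quadratic
differential `f_u df₀^{⊗ 2}`. The coefficient of `ω^{⊗ 2}_{γ_{v,i,ν}}` is that of
`X ^ (p ^ (nᵢ - ν))` in the additive polynomial. -/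
def G (v : Fin (k + 1) → ℕ) (i : Fin k) (W : (Fin (k + 1) → ℕ) → SymH 𝕜 F) : SymH 𝕜 F :=
  W (T.gamma v i 0) + ∑ ν ∈ Finset.Icc 1 (T.n i), T.a i (T.n i - ν) • W (T.gamma v i ν)
    - ∑ l ∈ T.lambdas i, T.d i l • W (beta v l)

end Tower

end HKG

end

/-!
At `P` the differential `df₀` has order `N - 1`, where `N = ∑ᵢ (p ^ nᵢ - 1) m̄ᵢ - |G₀|`, and it has
neither zeros nor poles elsewhere: each step of the tower is étale away from `P`, because the
equation of `fᵢ` is additive with a nonzero linear coefficient. For the same reason the functions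
regular outside `P` are the polynomials in `f₀, …, f_k`, and these are spanned by the reduced
monomials (`u_ν < p ^ n_ν` for `ν ≥ 1`), whose pole orders `‖u‖` at `P` are pairwise distinct.
Therefore the holomorphic differentials are the combinations of the `f_u df₀` with `u` reduced
and `‖u‖ < N`. The number `N` itself is not a sum of two norms of reduced exponents, which gives
`2 g ≤ N + 1`; so `‖L‖ ≤ 2 g - 2` implies `‖L‖ ≤ N - 1`, and the `f_L df₀` are holomorphic.
Finally `φ` maps `G_{v,i}` to the product of `f_v df₀^{⊗ 2}` with the equation of `fᵢ`.
-/

noncomputable section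

namespace HKG

section Arithmetic

lemma two_mul_card_le_of_add_ne {N : ℤ} {S : Finset ℤ} (hS : S ⊆ Finset.Icc 0 N)
    (hN : ∀ x ∈ S, ∀ y ∈ S, x + y ≠ N) : 2 * S.card ≤ (N + 1).toNat := by
  have hdisj : Disjoint S (S.image (N - ·)) := by
    rw [Finset.disjoint_left]
    intro x hx hx'
    obtain ⟨y, hy, rfl⟩ := Finset.mem_image.mp hx'
    exact hN _ hx y hy (sub_add_cancel N y)
  have hsub : S ∪ S.image (N - ·) ⊆ Finset.Icc 0 N := by
    refine Finset.union_subset hS (Finset.image_subset_iff.mpr fun x hx => ?_)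
    have := Finset.mem_Icc.mp (hS hx)
    exact Finset.mem_Icc.mpr (by omega)
  calc 2 * S.card = (S ∪ S.image (N - ·)).card := by
        rw [Finset.card_union_of_disjoint hdisj, Finset.card_image_of_injective _
          sub_right_injective, two_mul]
    _ ≤ (Finset.Icc 0 N).card := Finset.card_le_card hsub
    _ = (N + 1).toNat := by rw [Int.card_Icc, sub_zero]

variable {p k : ℕ} {n b : Fin k → ℕ}

@[simp] lemma weight_zero : weight p n b 0 = p ^ ∑ j, n j := rfl

@[simp] lemma weight_succ (i : Fin k) :
    weight p n b i.succ = p ^ (∑ j ∈ Finset.Ioi i, n j) * b i := rfl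

lemma weight_pos (hp : p.Prime) (hb : ∀ i, (b i).Coprime p) (j : Fin (k + 1)) :
    0 < weight p n b j := by
  induction j using Fin.cases with
  | zero => exact pow_pos hp.pos _
  | succ i =>
    refine Nat.mul_pos (pow_pos hp.pos _) (Nat.pos_of_ne_zero fun h => hp.ne_one ?_)
    simpa only [h, Nat.coprime_zero_left] using hb i

lemma coprime_weight_last (hb : ∀ i, (b i).Coprime p) :
    (weight p n b (Fin.last k)).Coprime p := by
  cases k with
  | zero => exact Nat.coprime_one_left p
  | succ k =>
    have hIoi : Finset.Ioi (Fin.last k) = ∅ := Finset.Ioi_eq_empty.mpr fun j _ => Fin.le_last j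
    rw [← Fin.succ_last, weight_succ, hIoi, Finset.sum_empty, pow_zero, one_mul]
    exact hb _

lemma wnorm_add (u v : Fin (k + 1) → ℕ) :
    wnorm p n b (u + v) = wnorm p n b u + wnorm p n b v := by
  simp only [wnorm, Pi.add_apply, add_mul, Finset.sum_add_distrib]

lemma wnorm_single (j : Fin (k + 1)) (e : ℕ) :
    wnorm p n b (Pi.single j e) = e * weight p n b j := by
  simp [wnorm, Pi.single_apply]

lemma sum_Ici_eq_add_sum_Ioi (i : Fin k) :
    ∑ j ∈ Finset.Ici i, n j = n i + ∑ j ∈ Finset.Ioi i, n j := by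
  rw [← Finset.Ioi_insert, Finset.sum_insert Finset.notMem_Ioi_self]

lemma pow_sum_Ici_dvd_weight (i : Fin k) {j : Fin (k + 1)} (hj : j < i.succ) :
    p ^ (∑ l ∈ Finset.Ici i, n l) ∣ weight p n b j := by
  induction j using Fin.cases with
  | zero => exact pow_dvd_pow _ (Finset.sum_le_sum_of_subset (Finset.subset_univ _))
  | succ m =>
    refine Dvd.dvd.mul_right (pow_dvd_pow _ (Finset.sum_le_sum_of_subset fun l hl => ?_)) _
    exact Finset.mem_Ioi.mpr ((Fin.succ_lt_succ_iff.mp hj).trans_le (Finset.mem_Ici.mp hl))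

lemma pow_sum_Ici_succ_dvd_weight (hn : ∀ i, 0 < n i) (i : Fin k) {j : Fin (k + 1)}
    (hj : j < i.castSucc) : p ^ (∑ l ∈ Finset.Ici i, n l + 1) ∣ weight p n b j := by
  obtain ⟨m, hm⟩ := Fin.exists_succ_eq.mpr (Fin.ne_zero_of_lt hj)
  have hmi : m < i := Fin.castSucc_lt_castSucc_iff.mp (hm ▸ Fin.castSucc_lt_succ)
  refine (pow_dvd_pow _ ?_).trans (pow_sum_Ici_dvd_weight m (hm ▸ hj))
  rw [sum_Ici_eq_add_sum_Ioi m, add_comm]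
  exact add_le_add (hn m) (Finset.sum_le_sum_of_subset fun l hl =>
    Finset.mem_Ioi.mpr (hmi.trans_le (Finset.mem_Ici.mp hl)))

lemma eq_zero_of_sum_mul_weight_eq_zero (hp : p.Prime) (hb : ∀ i, (b i).Coprime p)
    (u : Fin (k + 1) → ℤ) (hu : ∀ i : Fin k, |u i.succ| < (p : ℤ) ^ n i)
    (h : ∑ j, u j * (weight p n b j : ℤ) = 0) : u = 0 := by
  have hp0 : (p : ℤ) ≠ 0 := mod_cast hp.ne_zero
  have hsucc : ∀ i : Fin k, u i.succ = 0 := by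
    intro i
    induction i using WellFoundedGT.induction with
    | ind i ih =>
      have hdvd : ((p : ℤ) ^ ∑ l ∈ Finset.Ici i, n l) ∣ u i.succ * (weight p n b i.succ : ℤ) := by
        rw [← Finset.add_sum_erase _ _ (Finset.mem_univ i.succ)] at h
        rw [eq_neg_of_add_eq_zero_left h, dvd_neg]
        refine Finset.dvd_sum fun j hj => ?_
        rcases lt_or_gt_of_ne (Finset.ne_of_mem_erase hj) with hji | hji
        · exact Dvd.dvd.mul_left (mod_cast pow_sum_Ici_dvd_weight i hji) _
        · obtain ⟨m, rfl⟩ := Fin.exists_succ_eq.mpr (Fin.ne_zero_of_lt hji)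
          rw [ih m (Fin.succ_lt_succ_iff.mp hji), zero_mul]
          exact dvd_zero _
      rw [sum_Ici_eq_add_sum_Ioi, weight_succ, add_comm, pow_add, Nat.cast_mul, Nat.cast_pow,
        mul_left_comm] at hdvd
      have hcop : IsCoprime ((p : ℤ) ^ n i) (b i : ℤ) :=
        (Nat.isCoprime_iff_coprime.mpr (hb i).symm).pow_left
      exact Int.eq_zero_of_abs_lt_dvd
        (hcop.dvd_of_dvd_mul_right ((mul_dvd_mul_iff_left (pow_ne_zero _ hp0)).mp hdvd)) (hu i)
  have hzero : u 0 = 0 := by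
    simp only [Fin.sum_univ_succ, hsucc, zero_mul, Finset.sum_const_zero, add_zero, weight_zero,
      Nat.cast_pow] at h
    exact (mul_eq_zero.mp h).resolve_right (pow_ne_zero _ hp0)
  exact funext (Fin.cases hzero hsucc)

/-- The exponents of the monomials `f₀ ^ L₀ ⋯ f_k ^ L_k` in which none of the equations of
`f₁, …, f_k` can be applied. These monomials form a `𝕜`-basis of `𝕜[f₀, …, f_k]`. -/
def Reduced (p : ℕ) {k : ℕ} (n : Fin k → ℕ) (L : Fin (k + 1) → ℕ) : Prop :=
  ∀ i : Fin k, L i.succ < p ^ n i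

lemma reduced_of_mem_reducedExponents (hp : 0 < p) {i : Fin k} {l : Fin (k + 1) → ℕ}
    (hl : l ∈ reducedExponents p n i) : Reduced p n l := by
  intro m
  rcases lt_or_ge m i with h | h
  · exact hl.2 m h
  · rw [hl.1 _ (Fin.succ_le_succ_iff.mpr h)]
    exact pow_pos hp _

lemma injOn_wnorm_reduced (hp : p.Prime) (hb : ∀ i, (b i).Coprime p) :
    Set.InjOn (wnorm p n b) {L | Reduced p n L} := by
  intro L hL K hK h
  have hsub := eq_zero_of_sum_mul_weight_eq_zero (n := n) hp hb (fun j => (L j : ℤ) - K j)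
    (fun i => Int.abs_sub_lt_of_lt_lt (mod_cast hK i) (mod_cast hL i)) (by
      simp only [sub_mul, Finset.sum_sub_distrib, sub_eq_zero]
      exact_mod_cast h)
  exact funext fun j => by simpa [sub_eq_zero] using congrFun hsub j

/-- The order of the pole at `P` of the logarithmic derivative `(dfₘ / df₀) / fₘ`. It is
`-|G₀|` for `m = 0` and grows by `(p ^ nᵢ - 1) * m̄ᵢ` at each step `i` of the tower. -/
def logDerivOrder (p : ℕ) {k : ℕ} (n b : Fin k → ℕ) (m : Fin (k + 1)) : ℤ :=
  Fin.partialSum (fun i => ((p : ℤ) ^ n i - 1) * weight p n b i.succ) m - weight p n b 0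

lemma logDerivOrder_zero : logDerivOrder p n b 0 = -(weight p n b 0 : ℤ) := by
  rw [logDerivOrder, Fin.partialSum_zero, zero_sub]

lemma logDerivOrder_succ (i : Fin k) : logDerivOrder p n b i.succ =
    logDerivOrder p n b i.castSucc + ((p : ℤ) ^ n i - 1) * weight p n b i.succ := by
  rw [logDerivOrder, logDerivOrder, Fin.partialSum_succ]
  ring

lemma strictMono_logDerivOrder (hp : p.Prime) (hn : ∀ i, 0 < n i) (hb : ∀ i, (b i).Coprime p) :
    StrictMono (logDerivOrder p n b) := by
  refine Fin.strictMono_iff_lt_succ.mpr fun i => ?_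
  rw [logDerivOrder_succ, lt_add_iff_pos_right]
  exact mul_pos (sub_pos.mpr (mod_cast Nat.one_lt_pow (hn i).ne' hp.one_lt))
    (mod_cast weight_pos hp hb _)

/-- The Frobenius number of the semigroup of the pole orders at `P`, that is, the largest integer
that is not of the form `‖L‖`. It is `2 g - 1`, the divisor of `df₀` being `(2 g - 2) P`. -/
def frobeniusNumber (p : ℕ) {k : ℕ} (n b : Fin k → ℕ) : ℤ :=
  logDerivOrder p n b (Fin.last k)

lemma logDerivOrder_le_frobeniusNumber (hp : p.Prime) (hn : ∀ i, 0 < n i)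
    (hb : ∀ i, (b i).Coprime p) (m : Fin (k + 1)) :
    logDerivOrder p n b m ≤ frobeniusNumber p n b :=
  (strictMono_logDerivOrder hp hn hb).monotone (Fin.le_last m)

lemma frobeniusNumber_eq : frobeniusNumber p n b =
    ∑ i : Fin k, ((p : ℤ) ^ n i - 1) * weight p n b i.succ - weight p n b 0 := by
  rw [frobeniusNumber, logDerivOrder, Fin.partialSum, Fin.val_last,
    List.take_of_length_le (List.length_ofFn).le, List.sum_ofFn]

lemma wnorm_add_wnorm_ne_frobeniusNumber (hp : p.Prime) (hb : ∀ i, (b i).Coprime p)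
    {L K : Fin (k + 1) → ℕ} (hL : Reduced p n L) (hK : Reduced p n K) :
    (wnorm p n b L : ℤ) + wnorm p n b K ≠ frobeniusNumber p n b := by
  intro h
  have hrel := eq_zero_of_sum_mul_weight_eq_zero (n := n) hp hb
    (Fin.cases ((L 0 : ℤ) + K 0 + 1) fun i => (L i.succ : ℤ) + K i.succ - ((p : ℤ) ^ n i - 1))
    (fun i => by
      have hLi : (L i.succ : ℤ) < (p : ℤ) ^ n i := mod_cast hL i
      have hKi : (K i.succ : ℤ) < (p : ℤ) ^ n i := mod_cast hK i
      rw [Fin.cases_succ, abs_lt]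
      omega)
    (by
      simp only [frobeniusNumber_eq, wnorm, Fin.sum_univ_succ, Nat.cast_add, Nat.cast_sum,
        Nat.cast_mul] at h
      simp only [Fin.sum_univ_succ, Fin.cases_zero, Fin.cases_succ, sub_mul, add_mul, one_mul,
        Finset.sum_sub_distrib, Finset.sum_add_distrib] at h ⊢
      linarith)
  have hzero : (L 0 : ℤ) + K 0 + 1 = 0 := congrFun hrel 0
  omega

/-- The exponents `L` of the basis `f_L df₀` of `H⁰(X, Ω)`. -/
def differentialExponents (p : ℕ) {k : ℕ} (n b : Fin k → ℕ) : Set (Fin (k + 1) → ℕ) :=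
  {L | Reduced p n L ∧ (wnorm p n b L : ℤ) < frobeniusNumber p n b}

lemma injOn_wnorm_differentialExponents (hp : p.Prime) (hb : ∀ i, (b i).Coprime p) :
    Set.InjOn (fun L => (wnorm p n b L : ℤ)) (differentialExponents p n b) :=
  Nat.cast_injective.comp_injOn ((injOn_wnorm_reduced hp hb).mono fun _ hL => hL.1)

lemma finite_differentialExponents (hp : p.Prime) (hb : ∀ i, (b i).Coprime p) :
    (differentialExponents p n b).Finite := by
  refine .of_finite_image ((Set.finite_Icc 0 (frobeniusNumber p n b)).subset ?_)
    (injOn_wnorm_differentialExponents hp hb)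
  rintro _ ⟨L, hL, rfl⟩
  exact ⟨Int.natCast_nonneg _, hL.2.le⟩

lemma two_mul_ncard_differentialExponents_le (hp : p.Prime) (hb : ∀ i, (b i).Coprime p) :
    2 * (differentialExponents p n b).ncard ≤ (frobeniusNumber p n b + 1).toNat := by
  have hinj := injOn_wnorm_differentialExponents (n := n) hp hb
  have hfin := (finite_differentialExponents (n := n) hp hb).image fun L => (wnorm p n b L : ℤ)
  rw [← hinj.ncard_image, Set.ncard_eq_toFinset_card _ hfin]
  refine two_mul_card_le_of_add_ne (fun x hx => ?_) fun x hx y hy => ?_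
  · obtain ⟨L, hL, rfl⟩ := hfin.mem_toFinset.mp hx
    exact Finset.mem_Icc.mpr ⟨Int.natCast_nonneg _, hL.2.le⟩
  · obtain ⟨L, hL, rfl⟩ := hfin.mem_toFinset.mp hx
    obtain ⟨K, hK, rfl⟩ := hfin.mem_toFinset.mp hy
    exact wnorm_add_wnorm_ne_frobeniusNumber hp hb hL.1 hK.1

lemma not_dvd_castSucc_of_wnorm_eq (hp : p.Prime) (hn : ∀ i, 0 < n i)
    (hb : ∀ i, (b i).Coprime p) {i : Fin k} {l : Fin (k + 1) → ℕ}
    (hl : l ∈ reducedExponents p n i) (h : wnorm p n b l = p ^ n i * weight p n b i.succ) :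
    ¬ p ∣ l i.castSucc := by
  intro hdvd
  have hpow : p ^ (∑ m ∈ Finset.Ici i, n m + 1) ∣ wnorm p n b l := by
    refine Finset.dvd_sum fun j _ => ?_
    rcases lt_trichotomy j i.castSucc with hj | rfl | hj
    · exact Dvd.dvd.mul_left (pow_sum_Ici_succ_dvd_weight hn i hj) _
    · rw [pow_succ, mul_comm]
      exact mul_dvd_mul hdvd (pow_sum_Ici_dvd_weight i Fin.castSucc_lt_succ)
    · rw [hl.1 j (Fin.castSucc_lt_iff_succ_le.mp hj), zero_mul]
      exact dvd_zero _
  rw [h, weight_succ, ← mul_assoc, ← pow_add, ← sum_Ici_eq_add_sum_Ioi, pow_succ] at hpow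
  have hpb : p ∣ b i := (Nat.mul_dvd_mul_iff_left (pow_pos hp.pos _)).mp hpow
  exact hp.ne_one (Nat.Coprime.eq_one_of_dvd (hb i).symm hpb)

end Arithmetic

section Differentials

open Polynomial TensorProduct

variable {𝕜 F : Type*} [Field 𝕜] [Field F] [Algebra 𝕜 F]

lemma exists_kaehlerDifferential_equiv_of_formallyEtale [Algebra 𝕜[X] F] [IsScalarTower 𝕜 𝕜[X] F]
    [Algebra.FormallyEtale 𝕜[X] F] :
    ∃ e : Ω[F⁄𝕜] ≃ₗ[F] F, e (KaehlerDifferential.D 𝕜 F (algebraMap 𝕜[X] F X)) = 1 := by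
  refine ⟨(KaehlerDifferential.tensorKaehlerEquivOfFormallyEtale 𝕜 𝕜[X] F).symm ≪≫ₗ
      AlgebraTensorModule.congr (LinearEquiv.refl F F) (KaehlerDifferential.polynomialEquiv 𝕜) ≪≫ₗ
      AlgebraTensorModule.rid 𝕜[X] F F, ?_⟩
  rw [LinearEquiv.trans_apply, LinearEquiv.trans_apply,
    KaehlerDifferential.tensorKaehlerEquivOfFormallyEtale_symm_D_algebraMap]
  simp

lemma exists_kaehlerDifferential_equiv_of_transcendental {x : F} (hx : Transcendental 𝕜 x)
    [Algebra.IsSeparable 𝕜⟮x⟯ F] :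
    ∃ e : Ω[F⁄𝕜] ≃ₗ[F] F, e (KaehlerDifferential.D 𝕜 F x) = 1 := by
  let : Algebra 𝕜[X] 𝕜⟮x⟯ := (aeval (IntermediateField.AdjoinSimple.gen 𝕜 x)).toAlgebra
  let : Algebra 𝕜[X] F := (aeval x).toAlgebra
  have hcoe : ∀ q : 𝕜[X], ((algebraMap 𝕜[X] 𝕜⟮x⟯ q : 𝕜⟮x⟯) : F) = aeval x q := fun q =>
    (aeval_algebraMap_apply F (IntermediateField.AdjoinSimple.gen 𝕜 x) q).symm
  have : IsScalarTower 𝕜[X] 𝕜⟮x⟯ F := .of_algebraMap_eq fun q => (hcoe q).symm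
  have : IsScalarTower 𝕜 𝕜[X] F := .of_algebraMap_eq fun c => (aeval_C x c).symm
  have : IsScalarTower 𝕜 𝕜[X] 𝕜⟮x⟯ := .of_algebraMap_eq fun c => (aeval_C _ c).symm
  have : FaithfulSMul 𝕜[X] 𝕜⟮x⟯ := (faithfulSMul_iff_algebraMap_injective _ _).mpr
    fun q r h => transcendental_iff_injective.mp hx (by rw [← hcoe, ← hcoe, h])
  have : IsFractionRing 𝕜[X] 𝕜⟮x⟯ := .of_field _ _ fun z => by
    obtain ⟨r, s, h⟩ := (IntermediateField.mem_adjoin_simple_iff 𝕜 (z : F)).mp z.2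
    exact ⟨r, s, Subtype.ext (by rw [IntermediateField.coe_div, h, hcoe, hcoe])⟩
  have : Algebra.FormallyEtale 𝕜[X] 𝕜⟮x⟯ := .of_isLocalization (nonZeroDivisors 𝕜[X])
  have : Algebra.FormallyEtale 𝕜⟮x⟯ F := .of_isSeparable _ _
  have : Algebra.FormallyEtale 𝕜[X] F := .comp 𝕜[X] 𝕜⟮x⟯ F
  obtain ⟨e, he⟩ := exists_kaehlerDifferential_equiv_of_formallyEtale (𝕜 := 𝕜) (F := F)
  have hX : algebraMap 𝕜[X] F X = x := aeval_X x
  exact ⟨e, hX ▸ he⟩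

end Differentials

section Valuations

variable {𝕜 F Γ₀ : Type*} [Field 𝕜] [Field F] [Algebra 𝕜 F] [LinearOrderedCommGroupWithZero Γ₀]
  {v : Valuation F Γ₀}

lemma valuation_natCast_eq_one (𝕜 : Type*) [Field 𝕜] [Algebra 𝕜 F] [v.IsTrivialOn 𝕜] {m : ℕ}
    (hm : (m : F) ≠ 0) : v (m : F) = 1 := by
  rw [← map_natCast (algebraMap 𝕜 F)] at hm ⊢
  exact Valuation.IsTrivialOn.eq_one _ fun h => hm (by rw [h, map_zero])

variable [v.IsTrivialOn 𝕜]

lemma valuation_smul_eq {c : 𝕜} (hc : c ≠ 0) (x : F) : v (c • x) = v x := by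
  rw [Algebra.smul_def, map_mul, Valuation.IsTrivialOn.eq_one c hc, one_mul]

lemma valuation_smul_le (c : 𝕜) (x : F) : v (c • x) ≤ v x := by
  rw [Algebra.smul_def, map_mul]
  exact mul_le_of_le_one_left' (Valuation.IsTrivialOn.valuation_algebraMap_le_one v c)

variable {ι : Type*} {x : ι → F} {d e : ι →₀ 𝕜}

lemma exists_leading_term (hinj : Set.InjOn (fun i => v (x i)) d.support)
    (h0 : Finsupp.linearCombination 𝕜 x d ≠ 0) :
    ∃ l ∈ d.support, (∀ m ∈ d.support, m ≠ l → v (x m) < v (x l)) ∧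
      v (Finsupp.linearCombination 𝕜 x d) = v (x l) ∧
      v (Finsupp.linearCombination 𝕜 x d - d l • x l) < v (x l) := by
  classical
  have hd : d ≠ 0 := fun h => h0 (by rw [h, map_zero])
  obtain ⟨l, hl, hmax⟩ := d.support.exists_max_image (fun i => v (x i))
    (Finsupp.support_nonempty_iff.mpr hd)
  have hlt : ∀ m ∈ d.support, m ≠ l → v (x m) < v (x l) := fun m hm hne =>
    (hmax m hm).lt_of_ne fun h => hne (hinj hm hl h)
  have hterm : ∀ m ∈ d.support, v (d m • x m) = v (x m) := fun m hm =>
    valuation_smul_eq (Finsupp.mem_support_iff.mp hm) _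
  have hval : v (Finsupp.linearCombination 𝕜 x d) = v (x l) := by
    rw [Finsupp.linearCombination_apply, Finsupp.sum, Valuation.map_sum_eq_of_lt _ hl, hterm l hl]
    intro m hm
    obtain ⟨hm, hml⟩ := Finset.mem_sdiff.mp hm
    rw [hterm m hm, hterm l hl]
    exact hlt m hm (Finset.notMem_singleton.mp hml)
  refine ⟨l, hl, hlt, hval, ?_⟩
  rw [Finsupp.linearCombination_apply, Finsupp.sum, ← Finset.add_sum_erase _ _ hl,
    add_sub_cancel_left]
  refine Valuation.map_sum_lt _ (by rwa [← hval, Valuation.ne_zero_iff]) fun m hm => ?_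
  rw [hterm m (Finset.mem_of_mem_erase hm)]
  exact hlt m (Finset.mem_of_mem_erase hm) (Finset.ne_of_mem_erase hm)

lemma valuation_le_valuation_linearCombination (hinj : Set.InjOn (fun i => v (x i)) d.support)
    (h0 : Finsupp.linearCombination 𝕜 x d ≠ 0) {l : ι} (hl : l ∈ d.support) :
    v (x l) ≤ v (Finsupp.linearCombination 𝕜 x d) := by
  obtain ⟨m, -, hlt, h, -⟩ := exists_leading_term hinj h0
  rw [h]
  by_cases hlm : l = m
  · rw [hlm]
  · exact (hlt l hl hlm).le

lemma exists_valuation_sub_smul_lt {s : Set ι} (hinj : Set.InjOn (fun i => v (x i)) s)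
    (hd : ↑d.support ⊆ s) (he : ↑e.support ⊆ s) (h0 : Finsupp.linearCombination 𝕜 x e ≠ 0)
    (hle : v (Finsupp.linearCombination 𝕜 x d) ≤ v (Finsupp.linearCombination 𝕜 x e)) :
    ∃ c : 𝕜, v (Finsupp.linearCombination 𝕜 x d - c • Finsupp.linearCombination 𝕜 x e) <
      v (Finsupp.linearCombination 𝕜 x e) := by
  rcases hle.lt_or_eq with hlt | heq
  · exact ⟨0, by rwa [zero_smul, sub_zero]⟩
  have h0' : Finsupp.linearCombination 𝕜 x d ≠ 0 := by
    rwa [← v.ne_zero_iff, heq, v.ne_zero_iff]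
  obtain ⟨l, hl, -, hdl, hdl'⟩ := exists_leading_term (hinj.mono hd) h0'
  obtain ⟨m, hm, -, hem, hem'⟩ := exists_leading_term (hinj.mono he) h0
  obtain rfl : l = m := hinj (hd hl) (he hm) (hdl.symm.trans (heq.trans hem))
  refine ⟨d l / e l, ?_⟩
  have hsub : Finsupp.linearCombination 𝕜 x d - (d l / e l) • Finsupp.linearCombination 𝕜 x e =
      (Finsupp.linearCombination 𝕜 x d - d l • x l) -
        (d l / e l) • (Finsupp.linearCombination 𝕜 x e - e l • x l) := by
    rw [smul_sub, smul_smul, div_mul_cancel₀ _ (Finsupp.mem_support_iff.mp hm)]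
    abel
  rw [hsub, hem]
  exact Valuation.map_sub_lt _ hdl' ((valuation_smul_le _ _).trans_lt hem')

end Valuations

section Derivations

variable {𝕜 F Γ₀ : Type*} [Field 𝕜] [Field F] [Algebra 𝕜 F] [LinearOrderedCommGroupWithZero Γ₀]
  {v : Valuation F Γ₀}

lemma valuation_derivation_div_le (D : Derivation 𝕜 F F) {x y : F} {κ : Γ₀}
    (hx : v (D x) ≤ v x * κ) (hy : v (D y) ≤ v y * κ) : v (D (x / y)) ≤ v (x / y) * κ := by
  rcases eq_or_ne y 0 with rfl | hy0
  · simp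
  have hvy : v y ≠ 0 := v.ne_zero_iff.mpr hy0
  have hbound : v (y • D x - x • D y) ≤ v x * v y * κ := by
    refine Valuation.map_sub_le _ ?_ ?_
    · rw [smul_eq_mul, map_mul, mul_comm (v x), mul_assoc]
      exact mul_le_mul_right hx _
    · rw [smul_eq_mul, map_mul, mul_assoc]
      exact mul_le_mul_right hy _
  rw [Derivation.leibniz_div, smul_eq_mul, map_mul, map_pow, map_inv₀, map_div₀]
  refine (mul_le_mul_right hbound _).trans_eq ?_
  field_simp

lemma derivation_pow_prime_pow {p : ℕ} [CharP 𝕜 p] (D : Derivation 𝕜 F F) (x : F) {j : ℕ}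
    (hj : j ≠ 0) : D (x ^ p ^ j) = 0 := by
  have := charP_of_injective_algebraMap (algebraMap 𝕜 F).injective p
  rw [Derivation.leibniz_pow, ← Nat.cast_smul_eq_nsmul F, Nat.cast_pow, CharP.cast_eq_zero,
    zero_pow hj, zero_smul]

variable {k : ℕ} {f : Fin (k + 1) → F} {L : Fin (k + 1) → ℕ}

lemma derivation_monom (D : Derivation 𝕜 F F) (hf : ∀ j, f j ≠ 0) :
    D (monom f L) = monom f L * ∑ j, (L j : F) * (D (f j) / f j) := by
  let : Differential F := ⟨D.restrictScalars ℤ⟩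
  have hlog : Differential.logDeriv (monom f L) = ∑ j, (L j : F) * (D (f j) / f j) := by
    rw [monom, Differential.logDeriv_prod _ _ _ fun j _ => pow_ne_zero _ (hf j)]
    exact Finset.sum_congr rfl fun j _ => Differential.logDeriv_pow _ _
  rw [← hlog]
  exact (mul_div_cancel₀ _ (Finset.prod_ne_zero_iff.mpr fun j _ => pow_ne_zero _ (hf j))).symm

variable [v.IsTrivialOn 𝕜]

lemma valuation_derivation_monom_le {D : Derivation 𝕜 F F} (hf : ∀ j, f j ≠ 0) {κ : Γ₀}
    (h : ∀ j, L j ≠ 0 → v (D (f j) / f j) ≤ κ) :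
    v (D (monom f L)) ≤ v (monom f L) * κ := by
  rw [derivation_monom D hf, map_mul]
  refine mul_le_mul_right (Valuation.map_sum_le _ fun j _ => ?_) _
  rw [← nsmul_eq_mul, ← Nat.cast_smul_eq_nsmul 𝕜]
  rcases eq_or_ne (L j) 0 with hj | hj
  · simp [hj]
  · exact (valuation_smul_le _ _).trans (h j hj)

lemma valuation_derivation_monom_eq {D : Derivation 𝕜 F F} (hf : ∀ j, f j ≠ 0)
    {m : Fin (k + 1)} (hm : (L m : F) ≠ 0)
    (h : ∀ j ≠ m, L j ≠ 0 → v (D (f j) / f j) < v (D (f m) / f m)) (hD : D (f m) ≠ 0) :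
    v (D (monom f L)) = v (monom f L) * v (D (f m) / f m) := by
  have hvm : v ((L m : F) * (D (f m) / f m)) = v (D (f m) / f m) := by
    rw [map_mul, valuation_natCast_eq_one 𝕜 hm, one_mul]
  rw [derivation_monom D hf, map_mul, Valuation.map_sum_eq_of_lt _ (Finset.mem_univ m), hvm]
  intro j hj
  have hjm : j ≠ m := Finset.notMem_singleton.mp (Finset.mem_sdiff.mp hj).2
  rw [hvm, ← nsmul_eq_mul, ← Nat.cast_smul_eq_nsmul 𝕜]
  rcases eq_or_ne (L j) 0 with hL | hL
  · simpa [hL, zero_lt_iff] using ⟨hD, hf m⟩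
  · exact (valuation_smul_le _ _).trans_lt (h j hjm hL)

end Derivations

section Places

variable {𝕜 F : Type*} [Field 𝕜] [Field F] [Algebra 𝕜 F] {O : ValuationSubring F}

lemma IsPlace.isTrivialOn (hO : IsPlace 𝕜 O) : O.valuation.IsTrivialOn 𝕜 where
  eq_one c hc := by
    have hle : ∀ c : 𝕜, O.valuation (algebraMap 𝕜 F c) ≤ 1 := fun c =>
      (O.valuation_le_one_iff _).mpr (hO.contains_constants c)
    have hinv := hle c⁻¹
    rw [map_inv₀, map_inv₀, inv_le_one₀ (by simpa [zero_lt_iff] using hc)] at hinv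
    exact (hle c).antisymm hinv

lemma IsUniformizer.valuation_lt_one {t : O} (ht : IsUniformizer O t) :
    O.valuation (t : F) < 1 := by
  rw [← O.valuation_lt_one_iff, ht]
  exact Ideal.mem_span_singleton_self t

lemma IsUniformizer.valuation_le {t : O} (ht : IsUniformizer O t) {x : F}
    (hx : O.valuation x < 1) : O.valuation x ≤ O.valuation (t : F) := by
  have hmem : (⟨x, (O.valuation_le_one_iff x).mp hx.le⟩ : O) ∈ IsLocalRing.maximalIdeal O :=
    (O.valuation_lt_one_iff _).mpr hx
  rw [ht, Ideal.mem_span_singleton'] at hmem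
  obtain ⟨a, ha⟩ := hmem
  exact (O.valuation_le_iff _ _).mpr ⟨a, congrArg Subtype.val ha⟩

lemma HasPoleOrder.valuation_mul_pow {t : O} (ht : IsUniformizer O t) {x : F} {m : ℕ}
    (hx : HasPoleOrder O x m) : O.valuation x * O.valuation (t : F) ^ m = 1 := by
  obtain ⟨t', ht', w, hw⟩ := hx
  rw [(ht'.valuation_le ht.valuation_lt_one).antisymm (ht.valuation_le ht'.valuation_lt_one),
    ← map_pow, ← map_mul, hw, O.valuation_unit]

end Places

lemma monom_add {k : ℕ} {F : Type*} [Field F] {f : Fin (k + 1) → F} (u v : Fin (k + 1) → ℕ) :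
    monom f (u + v) = monom f u * monom f v := by
  simp only [monom, Pi.add_apply, pow_add, Finset.prod_mul_distrib]

lemma monom_single {k : ℕ} {F : Type*} [Field F] {f : Fin (k + 1) → F} (j : Fin (k + 1)) (e : ℕ) :
    monom f (Pi.single j e) = f j ^ e := by
  rw [monom, Finset.prod_eq_single j (fun l _ hl => by rw [Pi.single_eq_of_ne hl, pow_zero])
    (absurd (Finset.mem_univ j)), Pi.single_eq_same]

namespace Tower

variable {p k : ℕ} {𝕜 F : Type*} [Field 𝕜] [Field F] [Algebra 𝕜 F] (T : Tower p k 𝕜 F)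

lemma pow_add_sum_smul_pow_eq (i : Fin k) :
    T.f i.succ ^ p ^ T.n i + ∑ j ∈ Finset.range (T.n i), T.a i j • T.f i.succ ^ p ^ j =
      Finsupp.linearCombination 𝕜 (monom T.f) (T.d i) := by
  have h := congrArg (Polynomial.eval (T.f i.succ)) (T.equation i)
  rw [Polynomial.eval_map_algebraMap, minpoly.aeval] at h
  simp only [stepPolynomial, Polynomial.eval_sub, Polynomial.eval_add, Polynomial.eval_pow,
    Polynomial.eval_X, Polynomial.eval_C, Polynomial.eval_finsetSum, Polynomial.eval_mul] at h
  simp only [Finsupp.linearCombination_apply, Finsupp.sum, Algebra.smul_def]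
  exact sub_eq_zero.mp h.symm

lemma monom_add_sum_smul_monom_eq (i : Fin k) (v : Fin (k + 1) → ℕ) :
    monom T.f (v + Pi.single i.succ (p ^ T.n i)) +
        ∑ j ∈ Finset.range (T.n i), T.a i j • monom T.f (v + Pi.single i.succ (p ^ j)) =
      ∑ l ∈ (T.d i).support, T.d i l • monom T.f (l + v) := by
  have h := congrArg (monom T.f v * ·) (T.pow_add_sum_smul_pow_eq i)
  simpa only [Finsupp.linearCombination_apply, Finsupp.sum, mul_add, Finset.mul_sum, mul_smul_comm,
    monom_add, monom_single, mul_comm (monom T.f v) (monom T.f _)] using h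

/-- The ring `𝕜[f₀, …, f_k]`, which is the ring of the functions that are regular outside `P`. -/
def coordinateRing : Subalgebra 𝕜 F :=
  Algebra.adjoin 𝕜 (Set.range T.f)

lemma f_mem_coordinateRing (j : Fin (k + 1)) : T.f j ∈ T.coordinateRing :=
  Algebra.subset_adjoin ⟨j, rfl⟩

lemma monom_mem_coordinateRing (L : Fin (k + 1) → ℕ) : monom T.f L ∈ T.coordinateRing :=
  prod_mem fun j _ => pow_mem (T.f_mem_coordinateRing j) _

lemma monom_mem_span_reduced (hp : 1 < p) (L : Colex (Fin (k + 1) → ℕ)) :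
    monom T.f (ofColex L) ∈ Submodule.span 𝕜 (monom T.f '' {L | Reduced p T.n L}) := by
  induction L using WellFoundedLT.induction with
  | ind L ih =>
  by_cases hL : Reduced p T.n (ofColex L)
  · exact Submodule.subset_span ⟨_, hL, rfl⟩
  obtain ⟨i, hi⟩ := not_forall.mp hL
  have hle : Pi.single i.succ (p ^ T.n i) ≤ ofColex L :=
    update_le_iff.mpr ⟨not_lt.mp hi, fun _ _ => Nat.zero_le _⟩
  obtain ⟨v, hv⟩ := le_iff_exists_add'.mp hle
  have hLv : ∀ j, L j = (v + Pi.single i.succ (p ^ T.n i) : Fin (k + 1) → ℕ) j := congrFun hv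
  rw [hv, eq_sub_of_add_eq (T.monom_add_sum_smul_monom_eq i v)]
  refine sub_mem (sum_mem fun l hl => Submodule.smul_mem _ _ (ih (toColex (l + v)) ?_))
    (sum_mem fun j hj => Submodule.smul_mem _ _
      (ih (toColex (v + Pi.single i.succ (p ^ j))) ?_))
  · have hl0 := (T.d_reduced i l hl).1
    refine ⟨i.succ, fun m hm => ?_, ?_⟩
    · simp [hLv, hl0 m hm.le, hm.ne']
    · simp [hLv, hl0, Nat.zero_lt_of_lt hp]
  · refine ⟨i.succ, fun m hm => ?_, ?_⟩
    · simp [hLv, hm.ne']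
    · simpa [hLv] using Nat.pow_lt_pow_right hp (Finset.mem_range.mp hj)

lemma exists_linearCombination_of_mem_coordinateRing (hp : 1 < p) {x : F}
    (hx : x ∈ T.coordinateRing) :
    ∃ d : (Fin (k + 1) → ℕ) →₀ 𝕜, ↑d.support ⊆ {L | Reduced p T.n L} ∧
      Finsupp.linearCombination 𝕜 (monom T.f) d = x := by
  suffices x ∈ Submodule.span 𝕜 (monom T.f '' {L | Reduced p T.n L}) from
    (Finsupp.mem_span_image_iff_linearCombination 𝕜).mp this
  rw [coordinateRing, Algebra.adjoin_range_eq_range_aeval] at hx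
  obtain ⟨q, rfl⟩ := hx
  rw [AlgHom.toRingHom_eq_coe, RingHom.coe_coe, MvPolynomial.aeval_def, MvPolynomial.eval₂_eq']
  refine sum_mem fun m _ => ?_
  rw [← Algebra.smul_def]
  exact Submodule.smul_mem _ _ (T.monom_mem_span_reduced hp (toColex m))

lemma exists_eq_div (x : F) : ∃ y ∈ T.coordinateRing, ∃ s ∈ T.coordinateRing, x = y / s := by
  have hx : x ∈ IntermediateField.adjoin 𝕜 (Set.range T.f) :=
    T.generate ▸ IntermediateField.mem_top
  obtain ⟨y, hy, s, hs, h⟩ := IntermediateField.mem_adjoin_iff_div.mp hx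
  exact ⟨y, hy, s, hs, h⟩

instance isTrivialOn_valuation : T.P.valuation.IsTrivialOn 𝕜 :=
  T.cover.place.isTrivialOn

/-- A uniformizer at the ramified place. -/
def uniformizer : T.P :=
  (T.pole 0).choose

lemma isUniformizer_uniformizer : IsUniformizer T.P T.uniformizer :=
  (T.pole 0).choose_spec.1

/-- The value at the ramified place of the functions with a simple pole, so that a function with a
pole of order `m` has the value `γ ^ m`. -/
def γ : T.P.ValueGroup :=
  (T.P.valuation (T.uniformizer : F))⁻¹

lemma valuation_uniformizer : T.P.valuation (T.uniformizer : F) = T.γ⁻¹ :=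
  (inv_inv _).symm

lemma valuation_le_inv_γ {x : F} (hx : T.P.valuation x < 1) : T.P.valuation x ≤ T.γ⁻¹ := by
  rw [← valuation_uniformizer]
  exact T.isUniformizer_uniformizer.valuation_le hx

lemma valuation_f (j : Fin (k + 1)) : T.P.valuation (T.f j) = T.γ ^ weight p T.n T.b j := by
  rw [γ, inv_pow]
  exact eq_inv_of_mul_eq_one_left ((T.pole j).valuation_mul_pow T.isUniformizer_uniformizer)

lemma valuation_monom (L : Fin (k + 1) → ℕ) :
    T.P.valuation (monom T.f L) = T.γ ^ wnorm p T.n T.b L := by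
  simp only [monom, map_prod, map_pow, valuation_f, wnorm, ← Finset.prod_pow_eq_pow_sum,
    ← pow_mul, mul_comm]

variable [hp : Fact p.Prime]

lemma one_lt_γ : 1 < T.γ := by
  refine (one_lt_inv₀ (zero_lt_iff.mpr fun h => ?_)).mpr
    T.isUniformizer_uniformizer.valuation_lt_one
  have h1 := (T.pole 0).valuation_mul_pow T.isUniformizer_uniformizer
  rw [h, zero_pow (weight_pos hp.out T.b_coprime 0).ne', mul_zero] at h1
  exact zero_ne_one h1

lemma γ_ne_zero : T.γ ≠ 0 :=
  (zero_lt_one.trans T.one_lt_γ).ne'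

lemma f_ne_zero (j : Fin (k + 1)) : T.f j ≠ 0 := by
  rw [← T.P.valuation.ne_zero_iff, valuation_f]
  exact pow_ne_zero _ T.γ_ne_zero

lemma injOn_valuation_monom :
    Set.InjOn (fun L => T.P.valuation (monom T.f L)) {L | Reduced p T.n L} := by
  intro L hL K hK h
  simp only [valuation_monom] at h
  exact injOn_wnorm_reduced hp.out T.b_coprime hL hK
    (pow_right_injective₀ (zero_lt_one.trans T.one_lt_γ) T.one_lt_γ.ne' h)

lemma exists_valuation_sub_algebraMap_lt_one {x : F} (hx : x ∈ T.P) :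
    ∃ c : 𝕜, T.P.valuation (x - algebraMap 𝕜 F c) < 1 := by
  obtain ⟨y, hy, s, hs, rfl⟩ := T.exists_eq_div x
  rcases eq_or_ne s 0 with rfl | hs0
  · exact ⟨0, by simp⟩
  obtain ⟨d, hd, rfl⟩ := T.exists_linearCombination_of_mem_coordinateRing hp.out.one_lt hy
  obtain ⟨e, he, rfl⟩ := T.exists_linearCombination_of_mem_coordinateRing hp.out.one_lt hs
  have hpos := zero_lt_iff.mpr (T.P.valuation.ne_zero_iff.mpr hs0)
  rw [← T.P.valuation_le_one_iff, map_div₀, div_le_one₀ hpos] at hx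
  obtain ⟨c, hc⟩ := exists_valuation_sub_smul_lt T.injOn_valuation_monom hd he hs0 hx
  refine ⟨c, ?_⟩
  rwa [← mul_div_cancel_right₀ (algebraMap 𝕜 F c) hs0, ← sub_div, ← Algebra.smul_def, map_div₀,
    div_lt_one₀ hpos]

end Tower

namespace Tower

variable {p k : ℕ} {𝕜 F : Type*} [Field 𝕜] [Field F] [Algebra 𝕜 F] (T : Tower p k 𝕜 F)

lemma exists_coord :
    ∃ e : Ω[F⁄𝕜] ≃ₗ[F] F, e (KaehlerDifferential.D 𝕜 F (T.f 0)) = 1 :=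
  have := T.cover.galois
  exists_kaehlerDifferential_equiv_of_transcendental T.cover.transcendental

/-- The coordinate `ω / df₀` of a differential `ω`. -/
def coord : Ω[F⁄𝕜] ≃ₗ[F] F :=
  T.exists_coord.choose

/-- The derivation `d / df₀` of `F`. -/
def deriv : Derivation 𝕜 F F :=
  T.coord.toLinearMap.compDer (KaehlerDifferential.D 𝕜 F)

lemma coord_D (x : F) : T.coord (KaehlerDifferential.D 𝕜 F x) = T.deriv x := rfl

lemma deriv_f_zero : T.deriv (T.f 0) = 1 :=
  T.exists_coord.choose_spec

lemma eq_coord_smul_D (ω : Ω[F⁄𝕜]) : ω = T.coord ω • KaehlerDifferential.D 𝕜 F (T.f 0) := by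
  apply T.coord.injective
  rw [map_smul, coord_D, deriv_f_zero, smul_eq_mul, mul_one]

lemma smul_deriv_f_succ [CharP 𝕜 p] (i : Fin k) :
    T.a i 0 • T.deriv (T.f i.succ) =
      T.deriv (Finsupp.linearCombination 𝕜 (monom T.f) (T.d i)) := by
  rw [← T.pow_add_sum_smul_pow_eq i, map_add, map_sum,
    derivation_pow_prime_pow _ _ (T.n_pos i).ne', zero_add,
    Finset.sum_eq_single_of_mem 0 (Finset.mem_range.mpr (T.n_pos i)), Derivation.map_smul,
    pow_zero, pow_one]
  intro j _ hj
  rw [Derivation.map_smul, derivation_pow_prime_pow _ _ hj, smul_zero]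

lemma lt_succ_of_mem_support_d {i : Fin k} {l : Fin (k + 1) → ℕ} (hl : l ∈ (T.d i).support)
    {j : Fin (k + 1)} (hj : l j ≠ 0) : j < i.succ :=
  lt_of_not_ge fun hij => hj ((T.d_reduced i l hl).1 j hij)

variable [hp : Fact p.Prime]

lemma support_d_subset (i : Fin k) : ↑(T.d i).support ⊆ {L | Reduced p T.n L} := fun l hl =>
  reduced_of_mem_reducedExponents hp.out.pos (T.d_reduced i l hl)

lemma valuation_linearCombination_d (i : Fin k) :
    T.P.valuation (Finsupp.linearCombination 𝕜 (monom T.f) (T.d i)) =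
      T.γ ^ (p ^ T.n i * weight p T.n T.b i.succ) := by
  have htop : T.P.valuation (T.f i.succ ^ p ^ T.n i) =
      T.γ ^ (p ^ T.n i * weight p T.n T.b i.succ) := by
    rw [map_pow, valuation_f, ← pow_mul, mul_comm]
  rw [← T.pow_add_sum_smul_pow_eq i, ← htop]
  refine Valuation.map_add_eq_of_lt_left _ ?_
  rw [htop]
  refine Valuation.map_sum_lt _ (pow_ne_zero _ T.γ_ne_zero) fun j hj => ?_
  refine (valuation_smul_le _ _).trans_lt ?_
  rw [map_pow, valuation_f, ← pow_mul, mul_comm (weight _ _ _ _)]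
  exact pow_lt_pow_right₀ T.one_lt_γ ((Nat.mul_lt_mul_right (weight_pos hp.out T.b_coprime _)).mpr
    (Nat.pow_lt_pow_right hp.out.one_lt (Finset.mem_range.mp hj)))

lemma linearCombination_d_ne_zero (i : Fin k) :
    Finsupp.linearCombination 𝕜 (monom T.f) (T.d i) ≠ 0 := by
  rw [← T.P.valuation.ne_zero_iff, valuation_linearCombination_d]
  exact pow_ne_zero _ T.γ_ne_zero

lemma exists_leading_exponent (i : Fin k) : ∃ l ∈ (T.d i).support,
    wnorm p T.n T.b l = p ^ T.n i * weight p T.n T.b i.succ ∧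
      ∀ m ∈ (T.d i).support, m ≠ l →
        T.P.valuation (monom T.f m) < T.P.valuation (monom T.f l) := by
  obtain ⟨l, hl, hlt, hval, -⟩ := exists_leading_term
    (T.injOn_valuation_monom.mono (T.support_d_subset i)) (T.linearCombination_d_ne_zero i)
  rw [valuation_linearCombination_d, valuation_monom] at hval
  exact ⟨l, hl, pow_right_injective₀ (zero_lt_one.trans T.one_lt_γ) T.one_lt_γ.ne' hval.symm, hlt⟩

lemma valuation_deriv_monom_le {i : Fin k} {l : Fin (k + 1) → ℕ} (hl : l ∈ (T.d i).support)
    (h : ∀ j < i.succ, T.P.valuation (T.deriv (T.f j) / T.f j) = T.γ ^ logDerivOrder p T.n T.b j) :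
    T.P.valuation (T.deriv (monom T.f l)) ≤
      T.P.valuation (monom T.f l) * T.γ ^ logDerivOrder p T.n T.b i.castSucc := by
  refine valuation_derivation_monom_le T.f_ne_zero fun j hj => ?_
  have hji := T.lt_succ_of_mem_support_d hl hj
  rw [h j hji]
  exact zpow_le_zpow_right₀ T.one_lt_γ.le
    ((strictMono_logDerivOrder hp.out T.n_pos T.b_coprime).monotone (Fin.le_castSucc_iff.mpr hji))

lemma valuation_deriv_monom_eq [CharP 𝕜 p] {i : Fin k} {l : Fin (k + 1) → ℕ}
    (hl : l ∈ (T.d i).support)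
    (hnorm : wnorm p T.n T.b l = p ^ T.n i * weight p T.n T.b i.succ)
    (h : ∀ j < i.succ, T.P.valuation (T.deriv (T.f j) / T.f j) = T.γ ^ logDerivOrder p T.n T.b j) :
    T.P.valuation (T.deriv (monom T.f l)) =
      T.P.valuation (monom T.f l) * T.γ ^ logDerivOrder p T.n T.b i.castSucc := by
  have hlast := h _ i.castSucc_lt_succ
  have hl0 : (l i.castSucc : F) ≠ 0 := by
    have := charP_of_injective_algebraMap (algebraMap 𝕜 F).injective p
    rw [Ne, CharP.cast_eq_zero_iff F p]
    exact not_dvd_castSucc_of_wnorm_eq hp.out T.n_pos T.b_coprime (T.d_reduced i l hl) hnorm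
  rw [← hlast]
  refine valuation_derivation_monom_eq (𝕜 := 𝕜) T.f_ne_zero hl0 (fun j hj hlj => ?_) fun h0 => ?_
  · have hji := T.lt_succ_of_mem_support_d hl hlj
    rw [hlast, h j hji]
    exact zpow_lt_zpow_right₀ T.one_lt_γ (strictMono_logDerivOrder hp.out T.n_pos T.b_coprime
      (lt_of_le_of_ne (Fin.le_castSucc_iff.mpr hji) hj))
  · rw [h0, zero_div, map_zero] at hlast
    exact zpow_ne_zero _ T.γ_ne_zero hlast.symm

lemma valuation_smul_deriv_f_succ [CharP 𝕜 p] {i : Fin k}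
    (h : ∀ j < i.succ, T.P.valuation (T.deriv (T.f j) / T.f j) = T.γ ^ logDerivOrder p T.n T.b j) :
    T.P.valuation (T.a i 0 • T.deriv (T.f i.succ)) =
      T.γ ^ (p ^ T.n i * weight p T.n T.b i.succ) * T.γ ^ logDerivOrder p T.n T.b i.castSucc := by
  obtain ⟨l, hl, hnorm, hlt⟩ := T.exists_leading_exponent i
  have hlead := T.valuation_deriv_monom_eq hl hnorm h
  have hterm : ∀ m ∈ (T.d i).support, T.P.valuation (T.deriv (T.d i m • monom T.f m)) =
      T.P.valuation (T.deriv (monom T.f m)) := fun m hm => by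
    rw [Derivation.map_smul, valuation_smul_eq (Finsupp.mem_support_iff.mp hm)]
  rw [smul_deriv_f_succ, Finsupp.linearCombination_apply, Finsupp.sum, map_sum,
    Valuation.map_sum_eq_of_lt _ hl, hterm l hl, hlead, valuation_monom, hnorm]
  intro m hm
  obtain ⟨hm, hml⟩ := Finset.mem_sdiff.mp hm
  rw [hterm m hm, hterm l hl, hlead]
  exact (T.valuation_deriv_monom_le hm h).trans_lt
    (mul_lt_mul_of_pos_right (hlt m hm (Finset.notMem_singleton.mp hml))
      (zero_lt_iff.mpr (zpow_ne_zero _ T.γ_ne_zero)))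

lemma a_zero_ne_zero_of_valuation [CharP 𝕜 p] {i : Fin k}
    (h : ∀ j < i.succ, T.P.valuation (T.deriv (T.f j) / T.f j) = T.γ ^ logDerivOrder p T.n T.b j) :
    T.a i 0 ≠ 0 := by
  intro ha
  have h := T.valuation_smul_deriv_f_succ h
  rw [ha, zero_smul, map_zero] at h
  exact mul_ne_zero (pow_ne_zero _ T.γ_ne_zero) (zpow_ne_zero _ T.γ_ne_zero) h.symm

variable [CharP 𝕜 p]

lemma valuation_deriv_f_div_f (j : Fin (k + 1)) :
    T.P.valuation (T.deriv (T.f j) / T.f j) = T.γ ^ logDerivOrder p T.n T.b j := by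
  induction j using WellFoundedLT.induction with
  | ind j ih =>
  induction j using Fin.cases with
  | zero =>
    rw [deriv_f_zero, map_div₀, map_one, valuation_f, logDerivOrder_zero, zpow_neg, zpow_natCast,
      one_div]
  | succ i =>
    have h := T.valuation_smul_deriv_f_succ ih
    rw [valuation_smul_eq (T.a_zero_ne_zero_of_valuation ih)] at h
    rw [map_div₀, h, valuation_f, ← zpow_natCast, ← zpow_natCast, ← zpow_add₀ T.γ_ne_zero,
      ← zpow_sub₀ T.γ_ne_zero, logDerivOrder_succ]
    congr 1
    push_cast
    ring

lemma a_zero_ne_zero (i : Fin k) : T.a i 0 ≠ 0 :=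
  T.a_zero_ne_zero_of_valuation fun j _ => T.valuation_deriv_f_div_f j

lemma valuation_deriv_le (x : F) :
    T.P.valuation (T.deriv x) ≤ T.P.valuation x * T.γ ^ frobeniusNumber p T.n T.b := by
  suffices key : ∀ y ∈ T.coordinateRing,
      T.P.valuation (T.deriv y) ≤ T.P.valuation y * T.γ ^ frobeniusNumber p T.n T.b by
    obtain ⟨y, hy, s, hs, rfl⟩ := T.exists_eq_div x
    exact valuation_derivation_div_le _ (key y hy) (key s hs)
  intro y hy
  rcases eq_or_ne y 0 with rfl | hy0
  · simp
  obtain ⟨d, hd, rfl⟩ := T.exists_linearCombination_of_mem_coordinateRing hp.out.one_lt hy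
  conv_lhs => rw [Finsupp.linearCombination_apply, Finsupp.sum, map_sum]
  refine Valuation.map_sum_le _ fun l hl => ?_
  calc T.P.valuation (T.deriv (d l • monom T.f l))
      ≤ T.P.valuation (T.deriv (monom T.f l)) := by
        rw [Derivation.map_smul]
        exact valuation_smul_le _ _
    _ ≤ T.P.valuation (monom T.f l) * T.γ ^ frobeniusNumber p T.n T.b := by
        refine valuation_derivation_monom_le T.f_ne_zero fun j _ => ?_
        rw [valuation_deriv_f_div_f]
        exact zpow_le_zpow_right₀ T.one_lt_γ.le
          (logDerivOrder_le_frobeniusNumber hp.out T.n_pos T.b_coprime j)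
    _ ≤ _ := mul_le_mul_left (valuation_le_valuation_linearCombination
        (T.injOn_valuation_monom.mono hd) hy0 hl) _

lemma valuation_deriv_le_of_mem {x : F} (hx : x ∈ T.P) :
    T.P.valuation (T.deriv x) ≤ T.γ ^ (frobeniusNumber p T.n T.b - 1) := by
  obtain ⟨c, hc⟩ := T.exists_valuation_sub_algebraMap_lt_one hx
  have h := T.valuation_deriv_le (x - algebraMap 𝕜 F c)
  rw [map_sub, Derivation.map_algebraMap, sub_zero] at h
  refine h.trans ((mul_le_mul_left (T.valuation_le_inv_γ hc) _).trans_eq ?_)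
  rw [zpow_sub_one₀ T.γ_ne_zero, mul_comm]

lemma valuation_deriv_uniformizer :
    T.P.valuation (T.deriv (T.uniformizer : F)) = T.γ ^ (frobeniusNumber p T.n T.b - 1) := by
  let : Differential F := ⟨T.deriv.restrictScalars ℤ⟩
  set w := weight p T.n T.b (Fin.last k)
  set ℓ := T.f (Fin.last k)
  set t := (T.uniformizer : F)
  set N := frobeniusNumber p T.n T.b
  have ht0 : t ≠ 0 := by
    rw [← T.P.valuation.ne_zero_iff, valuation_uniformizer]
    exact inv_ne_zero T.γ_ne_zero
  have hunit : T.P.valuation (ℓ * t ^ w) = 1 := by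
    rw [map_mul, map_pow, valuation_f, valuation_uniformizer, inv_pow,
      mul_inv_cancel₀ (pow_ne_zero _ T.γ_ne_zero)]
  have hlog : (w : F) * Differential.logDeriv t =
      Differential.logDeriv (ℓ * t ^ w) - Differential.logDeriv ℓ := by
    rw [Differential.logDeriv_mul _ _ (T.f_ne_zero _) (pow_ne_zero _ ht0),
      Differential.logDeriv_pow, add_sub_cancel_left]
  have hℓ : T.P.valuation (Differential.logDeriv ℓ) = T.γ ^ N := T.valuation_deriv_f_div_f _
  have hlt : T.P.valuation (Differential.logDeriv (ℓ * t ^ w)) <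
      T.P.valuation (Differential.logDeriv ℓ) := by
    rw [hℓ, Differential.logDeriv, map_div₀, hunit, div_one]
    exact (T.valuation_deriv_le_of_mem ((T.P.valuation_le_one_iff _).mp hunit.le)).trans_lt
      (zpow_lt_zpow_right₀ T.one_lt_γ (sub_one_lt N))
  have hw : (w : F) ≠ 0 := by
    have := charP_of_injective_algebraMap (algebraMap 𝕜 F).injective p
    rw [Ne, CharP.cast_eq_zero_iff F p]
    exact fun h => hp.out.ne_one
      (Nat.Coprime.eq_one_of_dvd (coprime_weight_last T.b_coprime).symm h)
  have ht : T.P.valuation (Differential.logDeriv t) = T.γ ^ N := by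
    rw [← hℓ, ← Valuation.map_sub_eq_of_lt_right _ hlt, ← hlog, map_mul,
      valuation_natCast_eq_one 𝕜 hw, one_mul]
  rw [zpow_sub_one₀ T.γ_ne_zero, ← ht, ← valuation_uniformizer, ← map_mul]
  exact congrArg _ (div_mul_cancel₀ _ ht0).symm

end Tower

section Dedekind

open Polynomial

lemma integralClosure_eq_adjoin_singleton {A K L : Type*} [CommRing A] [IsDomain A]
    [IsIntegrallyClosed A] [Field K] [Field L] [Algebra A K] [IsFractionRing A K] [Algebra K L]
    [Algebra A L] [IsScalarTower A K L] [FiniteDimensional K L] [Algebra.IsSeparable K L]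
    {y : L} (hy : Algebra.adjoin K {y} = ⊤) (hyA : IsIntegral A y) (u : Aˣ)
    (hu : aeval y (derivative (minpoly K y)) = algebraMap A L u) :
    integralClosure A L = Algebra.adjoin A {y} := by
  have hle : Algebra.adjoin A {y} ≤ integralClosure A L :=
    Algebra.adjoin_le (Set.singleton_subset_iff.mpr hyA)
  refine le_antisymm (fun x hx => ?_) hle
  have hdual : x ∈ (Algebra.traceForm K L).dualSubmodule
      (Subalgebra.toSubmodule (Algebra.adjoin A {y})) := by
    rw [LinearMap.BilinForm.mem_dualSubmodule]
    intro w hw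
    rw [Algebra.traceForm_apply, Submodule.one_eq_range]
    exact IsIntegrallyClosed.isIntegral_iff.mp
      (Algebra.isIntegral_trace (L := K) (hx.mul (hle hw)))
  rw [traceForm_dualSubmodule_adjoin A K hy hyA, hu] at hdual
  obtain ⟨w, hw, rfl⟩ := hdual
  have hinv : (algebraMap A L u)⁻¹ = algebraMap A L (u⁻¹ : Aˣ) :=
    inv_eq_of_mul_eq_one_right (by rw [← map_mul, Units.mul_inv, map_one])
  rw [hinv]
  exact mul_mem (Subalgebra.algebraMap_mem _ _) hw

lemma isDedekindDomain_of_ringEquiv {A B : Type*} [CommRing A] [CommRing B] [IsDedekindDomain A]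
    (e : A ≃+* B) : IsDedekindDomain B :=
  have : IsDomain B := MulEquiv.isDomain A e.symm.toMulEquiv
  have := isNoetherianRing_of_ringEquiv A e
  have := Ring.DimensionLEOne.of_ringEquiv e.symm
  have := IsIntegrallyClosed.of_equiv e
  have : IsDedekindRing B := { }
  inferInstance

lemma isDedekindDomain_adjoin_singleton {A K F : Type*} [CommRing A] [IsDedekindDomain A]
    [Field K] [Field F] [Algebra A K] [IsFractionRing A K] [Algebra K F] [Algebra A F]
    [IsScalarTower A K F] {z : F} (hz : IsIntegral A z) (u : Aˣ)
    (hu : aeval z (derivative (minpoly K z)) = algebraMap A F u) :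
    IsDedekindDomain (Algebra.adjoin A {z}) := by
  have hzK : IsIntegral K z := hz.tower_top
  have hsep : IsSeparable K z :=
    (separable_iff_derivative_ne_zero (minpoly.irreducible hzK)).mpr fun h => by
      rw [h, map_zero] at hu
      exact (u.isUnit.map (algebraMap A F)).ne_zero hu.symm
  have := (IntermediateField.isSeparable_adjoin_simple_iff_isSeparable K F).mpr hsep
  have := IntermediateField.adjoin.finiteDimensional hzK
  have : IsScalarTower A K⟮z⟯ F := IsScalarTower.of_algebraMap_eq fun _ => rfl
  let ι := IsScalarTower.toAlgHom A K⟮z⟯ F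
  have hι : Function.Injective ι := (algebraMap K⟮z⟯ F).injective
  let y := IntermediateField.AdjoinSimple.gen K z
  have hy : Algebra.adjoin K {y} = ⊤ := by
    have := (IntermediateField.adjoin.powerBasis hzK).adjoin_gen_eq_top
    rwa [IntermediateField.adjoin.powerBasis_gen] at this
  have hyA : IsIntegral A y := (isIntegral_algHom_iff ι hι).mp hz
  have huy : aeval y (derivative (minpoly K y)) = algebraMap A K⟮z⟯ u := by
    apply hι
    rw [AlgHom.commutes, ← hu, IntermediateField.minpoly_gen]
    exact (aeval_algebraMap_apply F y _).symm
  have := integralClosure.isDedekindDomain A K K⟮z⟯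
  rw [integralClosure_eq_adjoin_singleton hy hyA u huy] at this
  have hmap : (Algebra.adjoin A {y}).map ι = Algebra.adjoin A {z} := AlgHom.map_adjoin_singleton ..
  exact isDedekindDomain_of_ringEquiv (((Algebra.adjoin A {y}).equivMapOfInjective ι hι).trans
    (Subalgebra.equivOfEq _ _ hmap)).toRingEquiv

variable {𝕜 F : Type*} [Field 𝕜] [Field F] [Algebra 𝕜 F]

lemma isPrincipalIdealRing_adjoin_singleton (x : F) :
    IsPrincipalIdealRing (Algebra.adjoin 𝕜 {x}) := by
  rw [Algebra.adjoin_singleton_eq_range_aeval]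
  exact IsPrincipalIdealRing.of_surjective (aeval (R := 𝕜) x).rangeRestrict
    (aeval (R := 𝕜) x).rangeRestrict_surjective

open IntermediateField.algebraAdjoinAdjoin in
lemma isDedekindDomain_adjoin_union_singleton {S : Set F} {z : F}
    [IsDedekindDomain (Algebra.adjoin 𝕜 S)] (hz : IsIntegral (Algebra.adjoin 𝕜 S) z) {c : 𝕜}
    (hc : c ≠ 0)
    (hd : aeval z (derivative (minpoly (IntermediateField.adjoin 𝕜 S) z)) = algebraMap 𝕜 F c) :
    IsDedekindDomain (Algebra.adjoin 𝕜 (S ∪ {z})) := by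
  have h := isDedekindDomain_adjoin_singleton (K := IntermediateField.adjoin 𝕜 S) hz
    (Units.map (algebraMap 𝕜 (Algebra.adjoin 𝕜 S)) (Units.mk0 c hc)) (by rw [hd]; rfl)
  rw [Algebra.adjoin_union_eq_adjoin_adjoin]
  exact h

open IsDedekindDomain in
lemma exists_valuationSubringAtPrime_eq {A : Type*} [CommRing A] [IsDedekindDomain A]
    [Algebra A F] [IsFractionRing A F] {O : ValuationSubring F} (hO : O ≠ ⊤)
    (hA : ∀ a : A, algebraMap A F a ∈ O) :
    ∃ v : HeightOneSpectrum A, v.valuationSubringAtPrime F = O := by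
  let q := (IsLocalRing.maximalIdeal O).comap ((algebraMap A F).codRestrict O hA)
  have hq : ∀ s ∉ q, (algebraMap A F s)⁻¹ ∈ O := fun s hs => by
    have hs1 : O.valuation (algebraMap A F s) = 1 :=
      (O.valuation_eq_one_iff ⟨_, hA s⟩).mp (IsLocalRing.notMem_maximalIdeal.mp hs)
    rw [← O.valuation_le_one_iff, map_inv₀, hs1, inv_one]
  have hbot : q ≠ ⊥ := by
    intro hbot
    refine hO (eq_top_iff.mpr fun x _ => ?_)
    obtain ⟨a, s, hs, rfl⟩ := IsFractionRing.div_surjective (A := A) x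
    rw [div_eq_mul_inv]
    exact mul_mem (hA a) (hq s fun h => nonZeroDivisors.ne_zero hs (by rwa [hbot] at h))
  refine ⟨⟨q, inferInstance, hbot⟩, ValuationSubring.eq_of_le_of_ne_top _ ?_ hO⟩
  rintro x ⟨a, s, hs, rfl⟩
  exact mul_mem (hA a) (hq s hs)

open IsDedekindDomain in
lemma derivation_mem_of_isDedekindDomain {A : Subalgebra 𝕜 F} [IsDedekindDomain A]
    [IsFractionRing A F] {O : ValuationSubring F} (hO : O ≠ ⊤) (hA : ∀ a ∈ A, a ∈ O)
    (δ : Derivation 𝕜 F F) (hδ : ∀ a ∈ A, δ a ∈ A) {x : F} (hx : x ∈ O) : δ x ∈ O := by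
  obtain ⟨v, rfl⟩ := exists_valuationSubringAtPrime_eq (A := A) hO fun a => hA a a.2
  obtain ⟨a, s, hs, rfl⟩ := hx
  have hinv : (s : F)⁻¹ ∈ v.valuationSubringAtPrime F := ⟨1, s, hs, by rw [map_one, one_mul]; rfl⟩
  change δ ((a : F) * (s : F)⁻¹) ∈ _
  rw [Derivation.leibniz, Derivation.leibniz_inv]
  have hδA : ∀ c : A, δ c ∈ v.valuationSubringAtPrime F := fun c => hA _ (hδ c c.2)
  exact add_mem (mul_mem (hA a a.2) (mul_mem (neg_mem (pow_mem hinv 2)) (hδA s)))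
    (mul_mem hinv (hδA a))

end Dedekind

section Derivations

variable {𝕜 F : Type*} [Field 𝕜] [Field F] [Algebra 𝕜 F]

lemma derivation_mem_of_mem_adjoin {δ : Derivation 𝕜 F F} {S : Set F} {B : Subalgebra 𝕜 F}
    (hS : S ⊆ B) (hδ : ∀ s ∈ S, δ s ∈ B) {x : F} (hx : x ∈ Algebra.adjoin 𝕜 S) : δ x ∈ B := by
  have hle : Algebra.adjoin 𝕜 S ≤ B := Algebra.adjoin_le hS
  induction hx using Algebra.adjoin_induction with
  | mem x hx => exact hδ x hx
  | algebraMap c => rw [Derivation.map_algebraMap]; exact zero_mem B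
  | add x y _ _ hx hy => rw [map_add]; exact add_mem hx hy
  | mul x y hxS hyS hx hy =>
    rw [Derivation.leibniz]
    exact add_mem (mul_mem (hle hxS) hy) (mul_mem (hle hyS) hx)

end Derivations

namespace Tower

open Polynomial

variable {p k : ℕ} {𝕜 F : Type*} [Field 𝕜] [Field F] [Algebra 𝕜 F] (T : Tower p k 𝕜 F)

lemma linearCombination_d_mem {B : Subalgebra 𝕜 F} {i : Fin k} (h : ∀ j < i.succ, T.f j ∈ B) :
    Finsupp.linearCombination 𝕜 (monom T.f) (T.d i) ∈ B := by
  refine sum_mem fun l hl => B.smul_mem (prod_mem fun j _ => ?_) _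
  by_cases hlj : l j = 0
  · rw [hlj, pow_zero]
    exact one_mem B
  · exact pow_mem (h j (T.lt_succ_of_mem_support_d hl hlj)) _

lemma isIntegral_f (hp : 1 < p) (i : Fin k) :
    IsIntegral (Algebra.adjoin 𝕜 (T.f '' Set.Iio i.succ)) (T.f i.succ) := by
  set R := Algebra.adjoin 𝕜 (T.f '' Set.Iio i.succ)
  have hD : Finsupp.linearCombination 𝕜 (monom T.f) (T.d i) ∈ R :=
    T.linearCombination_d_mem fun j hj => Algebra.subset_adjoin ⟨j, hj, rfl⟩
  let q : R[X] := ∑ j ∈ Finset.range (T.n i), T.a i j • X ^ p ^ j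
  have hq : q.degree < (p ^ T.n i : ℕ) := mem_degreeLT.mp <| sum_mem fun j hj =>
    mem_degreeLT.mpr <| (degree_smul_le _ _).trans_lt <| (degree_X_pow_le _).trans_lt <|
      Nat.cast_lt.mpr (Nat.pow_lt_pow_right hp (Finset.mem_range.mp hj))
  refine IsIntegral.of_aeval_monic (monic_X_pow_add hq) ?_ ?_
  · rw [natDegree_eq_of_degree_eq_some
      ((degree_add_eq_left_of_degree_lt (by rwa [degree_X_pow])).trans (degree_X_pow _))]
    exact (pow_pos (zero_lt_one.trans hp) _).ne'
  · have h : aeval (T.f i.succ) (X ^ p ^ T.n i + q) = algebraMap R F ⟨_, hD⟩ := by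
      simp only [q, map_add, map_sum, map_pow, aeval_X, AlgHom.map_smul_of_tower]
      exact T.pow_add_sum_smul_pow_eq i
    rw [h]
    exact isIntegral_algebraMap

lemma aeval_derivative_minpoly [CharP 𝕜 p] (i : Fin k) :
    aeval (T.f i.succ) (derivative (minpoly (stepField 𝕜 T.f i) (T.f i.succ))) =
      algebraMap 𝕜 F (T.a i 0) := by
  have := charP_of_injective_algebraMap (algebraMap 𝕜 F).injective p
  have hz : ∀ j ≠ 0, ((p ^ j : ℕ) : F) = 0 := fun j hj => by
    rw [Nat.cast_pow, CharP.cast_eq_zero, zero_pow hj]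
  rw [← eval_map_algebraMap, ← derivative_map, T.equation i, stepPolynomial]
  simp only [derivative_sub, derivative_add, derivative_X_pow, derivative_C, derivative_sum,
    derivative_C_mul, eval_add, eval_mul, eval_pow, eval_X, eval_C,
    eval_finsetSum, hz _ (T.n_pos i).ne', zero_mul, zero_add, sub_zero]
  rw [Finset.sum_eq_single_of_mem 0 (Finset.mem_range.mpr (T.n_pos i))]
  · simp
  · intro j _ hj
    simp [hz j hj]

instance isFractionRing_coordinateRing : IsFractionRing T.coordinateRing F :=
  IsFractionRing.of_field _ _ fun x => by
    obtain ⟨y, hy, s, hs, rfl⟩ := T.exists_eq_div x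
    exact ⟨⟨y, hy⟩, ⟨s, hs⟩, rfl⟩

variable [hp : Fact p.Prime] [CharP 𝕜 p]

instance isDedekindDomain_coordinateRing : IsDedekindDomain T.coordinateRing := by
  suffices key : ∀ m, IsDedekindDomain (Algebra.adjoin 𝕜 (T.f '' Set.Iic m)) by
    have h := key (Fin.last k)
    rwa [← Fin.top_eq_last, Set.Iic_top, Set.image_univ] at h
  intro m
  induction m using Fin.induction with
  | zero =>
    have h0 : T.f '' Set.Iic 0 = {T.f 0} := by
      rw [← bot_eq_zero, Set.Iic_bot, Set.image_singleton]
    rw [h0]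
    have := isPrincipalIdealRing_adjoin_singleton (𝕜 := 𝕜) (T.f 0)
    infer_instance
  | succ i ih =>
    have hIic : Set.Iic i.castSucc = Set.Iio i.succ := Set.ext fun j => Fin.le_castSucc_iff
    rw [hIic] at ih
    rw [← Set.Iio_union_right, Set.image_union, Set.image_singleton]
    exact isDedekindDomain_adjoin_union_singleton (T.isIntegral_f hp.out.one_lt i)
      (T.a_zero_ne_zero i) (T.aeval_derivative_minpoly i)

lemma deriv_f_mem_coordinateRing (j : Fin (k + 1)) : T.deriv (T.f j) ∈ T.coordinateRing := by
  induction j using WellFoundedLT.induction with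
  | ind j ih =>
  induction j using Fin.cases with
  | zero => rw [deriv_f_zero]; exact one_mem _
  | succ i =>
    rw [← inv_smul_smul₀ (T.a_zero_ne_zero i) (T.deriv _), smul_deriv_f_succ]
    refine Subalgebra.smul_mem _ (derivation_mem_of_mem_adjoin (S := T.f '' Set.Iio i.succ) ?_ ?_
      (T.linearCombination_d_mem fun j hj => Algebra.subset_adjoin ⟨j, hj, rfl⟩)) _
    · rintro _ ⟨j, -, rfl⟩
      exact T.f_mem_coordinateRing j
    · rintro _ ⟨j, hj, rfl⟩
      exact ih j hj

lemma deriv_mem_coordinateRing {x : F} (hx : x ∈ T.coordinateRing) :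
    T.deriv x ∈ T.coordinateRing :=
  derivation_mem_of_mem_adjoin Algebra.subset_adjoin
    (Set.forall_mem_range.mpr T.deriv_f_mem_coordinateRing) hx

end Tower

section RegularDifferentials

variable {𝕜 F : Type*} [Field 𝕜] [Field F] [Algebra 𝕜 F] {O : ValuationSubring F}

lemma mem_span_smul_D_iff (hO : IsPlace 𝕜 O) (e : Ω[F⁄𝕜] ≃ₗ[F] F) {t : F} (ht : t ∈ O)
    (h0 : e (KaehlerDifferential.D 𝕜 F t) ≠ 0)
    (hmax : ∀ x ∈ O, O.valuation (e (KaehlerDifferential.D 𝕜 F x)) ≤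
      O.valuation (e (KaehlerDifferential.D 𝕜 F t))) {ω : Ω[F⁄𝕜]} :
    ω ∈ Submodule.span 𝕜 {ω | ∃ a ∈ O, ∃ x ∈ O, ω = a • KaehlerDifferential.D 𝕜 F x} ↔
      O.valuation (e ω) ≤ O.valuation (e (KaehlerDifferential.D 𝕜 F t)) := by
  have := hO.isTrivialOn
  refine ⟨fun hω => ?_, fun hω => Submodule.subset_span
    ⟨e ω / e (KaehlerDifferential.D 𝕜 F t), ?_, t, ht, e.injective ?_⟩⟩
  · induction hω using Submodule.span_induction with
    | mem ω hω =>
      obtain ⟨a, ha, x, hx, rfl⟩ := hω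
      rw [map_smul, smul_eq_mul, map_mul]
      exact (mul_le_of_le_one_left' ((O.valuation_le_one_iff a).mpr ha)).trans (hmax x hx)
    | zero => simp
    | add ω η _ _ hω hη =>
      rw [map_add]
      exact Valuation.map_add_le _ hω hη
    | smul c ω _ hω =>
      rw [LinearMapClass.map_smul_of_tower]
      exact (valuation_smul_le c _).trans hω
  · rw [← O.valuation_le_one_iff, map_div₀]
    exact div_le_one_of_le₀ hω zero_le
  · rw [map_smul, smul_eq_mul, div_mul_cancel₀ _ h0]

lemma smul_dd_sq_mem_span {t x c w : F} (ht : t ∈ O) (hw : w ≠ 0) (htx : dd 𝕜 t = w • dd 𝕜 x)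
    (hc : O.valuation c ≤ O.valuation w ^ 2) :
    c • dd 𝕜 x ^ 2 ∈
      Submodule.span 𝕜 {q | ∃ a ∈ O, ∃ x ∈ O, ∃ y ∈ O, q = a • (dd 𝕜 x * dd 𝕜 y)} := by
  refine Submodule.subset_span ⟨c / w ^ 2, ?_, t, ht, t, ht, ?_⟩
  · rw [← O.valuation_le_one_iff, map_div₀, map_pow]
    exact div_le_one_of_le₀ hc zero_le
  · rw [htx, ← sq, smul_pow, smul_smul, div_mul_cancel₀ _ (pow_ne_zero _ hw)]

/-- The local ring of a place, as an algebra over the constants. -/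
def IsPlace.toSubalgebra (hO : IsPlace 𝕜 O) : Subalgebra 𝕜 F where
  toSubsemiring := O.toSubring.toSubsemiring
  algebraMap_mem' := hO.contains_constants

end RegularDifferentials

namespace Tower

variable {p k : ℕ} {𝕜 F : Type*} [Field 𝕜] [Field F] [Algebra 𝕜 F] (T : Tower p k 𝕜 F)
  {Q : ValuationSubring F}

lemma mem_of_mem_coordinateRing (hQ : IsPlace 𝕜 Q) (hQP : Q ≠ T.P) {x : F}
    (hx : x ∈ T.coordinateRing) : x ∈ Q := by
  have hle : T.coordinateRing ≤ hQ.toSubalgebra :=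
    Algebra.adjoin_le (Set.range_subset_iff.mpr fun j => T.regular j Q hQ hQP)
  exact hle hx

lemma dd_eq_deriv_smul (t : F) : dd 𝕜 t = T.deriv t • dd 𝕜 (T.f 0) := by
  rw [dd, dd, ← map_smul, ← coord_D, ← eq_coord_smul_D]

variable [hp : Fact p.Prime] [CharP 𝕜 p]

lemma mem_coordinateRing_iff {x : F} :
    x ∈ T.coordinateRing ↔ ∀ Q : ValuationSubring F, IsPlace 𝕜 Q → Q ≠ T.P → x ∈ Q := by
  refine ⟨fun hx Q hQ hQP => T.mem_of_mem_coordinateRing hQ hQP hx, fun hx => ?_⟩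
  have : IsIntegrallyClosedIn T.coordinateRing.toSubring F :=
    (isIntegrallyClosed_iff_isIntegrallyClosedIn (R := T.coordinateRing) F).mp inferInstance
  by_contra hxR
  obtain ⟨V, hRV, hxV⟩ := Subring.exists_le_valuationSubring_of_isIntegrallyClosedIn
    (R := T.coordinateRing.toSubring) hxR
  have hV : IsPlace 𝕜 V :=
    { contains_constants := fun c => hRV (T.coordinateRing.algebraMap_mem c)
      ne_top := fun h => hxV (h ▸ ValuationSubring.mem_top x) }
  refine hxV (hx V hV ?_)
  rintro rfl
  have hle := (T.P.valuation_le_one_iff _).mpr (hRV (T.f_mem_coordinateRing 0))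
  rw [valuation_f] at hle
  exact hle.not_gt (one_lt_pow₀ T.one_lt_γ (weight_pos hp.out T.b_coprime 0).ne')

lemma deriv_mem_of_isPlace (hQ : IsPlace 𝕜 Q) (hQP : Q ≠ T.P) {x : F} (hx : x ∈ Q) :
    T.deriv x ∈ Q :=
  derivation_mem_of_isDedekindDomain hQ.ne_top
    (fun _ ha => T.mem_of_mem_coordinateRing hQ hQP ha) T.deriv
    (fun _ ha => T.deriv_mem_coordinateRing ha) hx

lemma mem_span_smul_D_iff_of_ne (hQ : IsPlace 𝕜 Q) (hQP : Q ≠ T.P) {ω : Ω[F⁄𝕜]} :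
    ω ∈ Submodule.span 𝕜 {ω | ∃ a ∈ Q, ∃ x ∈ Q, ω = a • KaehlerDifferential.D 𝕜 F x} ↔
      T.coord ω ∈ Q := by
  have h1 : T.coord (KaehlerDifferential.D 𝕜 F (T.f 0)) = 1 := T.deriv_f_zero
  rw [mem_span_smul_D_iff hQ T.coord (T.regular 0 Q hQ hQP) (h1 ▸ one_ne_zero), h1, map_one,
    Q.valuation_le_one_iff]
  intro x hx
  rw [h1, map_one, Q.valuation_le_one_iff]
  exact T.deriv_mem_of_isPlace hQ hQP hx

lemma deriv_uniformizer_ne_zero : T.deriv (T.uniformizer : F) ≠ 0 := by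
  rw [← T.P.valuation.ne_zero_iff, valuation_deriv_uniformizer]
  exact zpow_ne_zero _ T.γ_ne_zero

lemma mem_span_smul_D_iff_valuation_le {ω : Ω[F⁄𝕜]} :
    ω ∈ Submodule.span 𝕜 {ω | ∃ a ∈ T.P, ∃ x ∈ T.P, ω = a • KaehlerDifferential.D 𝕜 F x} ↔
      T.P.valuation (T.coord ω) ≤ T.γ ^ (frobeniusNumber p T.n T.b - 1) := by
  rw [← valuation_deriv_uniformizer]
  refine mem_span_smul_D_iff T.cover.place T.coord T.uniformizer.2 T.deriv_uniformizer_ne_zero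
    fun x hx => ?_
  rw [coord_D, coord_D, valuation_deriv_uniformizer]
  exact T.valuation_deriv_le_of_mem hx

lemma mem_holomorphicDifferentials_iff {ω : Ω[F⁄𝕜]} :
    ω ∈ holomorphicDifferentials 𝕜 F ↔ T.coord ω ∈ T.coordinateRing ∧
      T.P.valuation (T.coord ω) ≤ T.γ ^ (frobeniusNumber p T.n T.b - 1) := by
  simp only [holomorphicDifferentials, Submodule.mem_iInf, mem_coordinateRing_iff]
  rw [← mem_span_smul_D_iff_valuation_le]
  refine ⟨fun h => ⟨fun Q hQ hQP => (T.mem_span_smul_D_iff_of_ne hQ hQP).mp (h Q hQ),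
    h T.P T.cover.place⟩, fun ⟨hne, hP⟩ Q hQ => ?_⟩
  rcases eq_or_ne Q T.P with rfl | hQP
  · exact hP
  · exact (T.mem_span_smul_D_iff_of_ne hQ hQP).mpr (hne Q hQ hQP)

lemma smul_dd_sq_mem_holomorphicQuadraticDifferentials {x : F} (hx : x ∈ T.coordinateRing)
    (hP : T.P.valuation x ≤ (T.γ ^ (frobeniusNumber p T.n T.b - 1)) ^ 2) :
    x • dd 𝕜 (T.f 0) ^ 2 ∈ holomorphicQuadraticDifferentials 𝕜 F := by
  simp only [holomorphicQuadraticDifferentials, Submodule.mem_iInf]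
  intro Q hQ
  rcases eq_or_ne Q T.P with rfl | hQP
  · refine smul_dd_sq_mem_span T.uniformizer.2 T.deriv_uniformizer_ne_zero (T.dd_eq_deriv_smul _) ?_
    rwa [valuation_deriv_uniformizer]
  · refine smul_dd_sq_mem_span (T.regular 0 Q hQ hQP) one_ne_zero (one_smul F _).symm ?_
    rw [map_one, one_pow, Q.valuation_le_one_iff]
    exact T.mem_of_mem_coordinateRing hQ hQP hx

lemma coord_mem_span_differentialExponents {ω : Ω[F⁄𝕜]} (hω : ω ∈ holomorphicDifferentials 𝕜 F) :
    T.coord ω ∈ Submodule.span 𝕜 (monom T.f '' differentialExponents p T.n T.b) := by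
  obtain ⟨hR, hP⟩ := T.mem_holomorphicDifferentials_iff.mp hω
  rcases eq_or_ne (T.coord ω) 0 with h0 | h0
  · exact h0 ▸ zero_mem _
  obtain ⟨d, hd, hdω⟩ := T.exists_linearCombination_of_mem_coordinateRing hp.out.one_lt hR
  rw [← hdω] at h0 hP ⊢
  refine sum_mem fun l hl => Submodule.smul_mem _ _ (Submodule.subset_span ⟨l, ⟨hd hl, ?_⟩, rfl⟩)
  have hle := (valuation_le_valuation_linearCombination (T.injOn_valuation_monom.mono hd)
    h0 hl).trans hP
  rw [valuation_monom, ← zpow_natCast, zpow_le_zpow_iff_right₀ T.one_lt_γ] at hle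
  exact Int.lt_of_le_sub_one hle

lemma two_mul_genus_le : 2 * genus 𝕜 F ≤ (frobeniusNumber p T.n T.b + 1).toNat := by
  refine (Nat.mul_le_mul_left 2 ?_).trans
    (two_mul_ncard_differentialExponents_le hp.out T.b_coprime)
  have hfin := finite_differentialExponents (n := T.n) hp.out T.b_coprime
  let ψ := (T.coord.toLinearMap.restrictScalars 𝕜).domRestrict (holomorphicDifferentials 𝕜 F)
  have hψ : Function.Injective ψ := T.coord.injective.comp Subtype.val_injective
  have hrange : LinearMap.range ψ ≤
      Submodule.span 𝕜 (monom T.f '' differentialExponents p T.n T.b) := by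
    rintro _ ⟨ω, rfl⟩
    exact T.coord_mem_span_differentialExponents ω.2
  calc genus 𝕜 F = Module.finrank 𝕜 (LinearMap.range ψ) := (LinearMap.finrank_range_of_inj hψ).symm
    _ ≤ Module.finrank 𝕜 (Submodule.span 𝕜 (monom T.f '' differentialExponents p T.n T.b)) := by
      have := Module.Finite.span_of_finite 𝕜 (hfin.image (monom T.f))
      exact Submodule.finrank_mono hrange
    _ ≤ (monom T.f '' differentialExponents p T.n T.b).ncard := by
      let := (hfin.image (monom T.f)).fintype
      rw [Set.ncard_eq_toFinset_card']
      exact finrank_span_le_card _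
    _ ≤ (differentialExponents p T.n T.b).ncard := Set.ncard_image_le hfin

lemma diff_mem_holomorphicDifferentials {L : Fin (k + 1) → ℕ}
    (hL : T.nrm L ≤ frobeniusNumber p T.n T.b - 1) : T.diff L ∈ holomorphicDifferentials 𝕜 F := by
  have hcoord : T.coord (T.diff L) = monom T.f L := by
    rw [diff, map_smul, coord_D, deriv_f_zero, smul_eq_mul, mul_one]
  rw [mem_holomorphicDifferentials_iff, hcoord, valuation_monom, ← zpow_natCast]
  exact ⟨T.monom_mem_coordinateRing L, zpow_le_zpow_right₀ T.one_lt_γ.le hL⟩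

lemma quadDiff_mem_holomorphicQuadraticDifferentials {u : Fin (k + 1) → ℕ}
    (hu : T.nrm u ≤ 2 * (frobeniusNumber p T.n T.b - 1)) :
    T.quadDiff u ∈ holomorphicQuadraticDifferentials 𝕜 F := by
  refine T.smul_dd_sq_mem_holomorphicQuadraticDifferentials (T.monom_mem_coordinateRing u) ?_
  rw [valuation_monom, ← zpow_natCast, ← zpow_natCast, ← zpow_mul, Nat.cast_ofNat,
    mul_comm (_ - 1)]
  exact zpow_le_zpow_right₀ T.one_lt_γ.le hu

end Tower

namespace Tower

variable {p k : ℕ} {𝕜 F : Type*} [Field 𝕜] [Field F] [Algebra 𝕜 F] (T : Tower p k 𝕜 F)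
  {i : Fin k} {v : Fin (k + 1) → ℕ} {W : (Fin (k + 1) → ℕ) → SymH 𝕜 F}

lemma canonicalMap_ι_diff {L : Fin (k + 1) → ℕ} (hL : T.diff L ∈ holomorphicDifferentials 𝕜 F) :
    canonicalMap 𝕜 F (SymmetricAlgebra.ι 𝕜 (holomorphicDifferentials 𝕜 F) ⟨T.diff L, hL⟩) =
      monom T.f L • dd 𝕜 (T.f 0) := by
  rw [canonicalMap, SymmetricAlgebra.lift_ι_apply]
  exact map_smul (SymmetricAlgebra.ι F (Ω[F⁄𝕜])) _ _

lemma represents_mul {L K : Fin (k + 1) → ℕ} (hL : T.diff L ∈ holomorphicDifferentials 𝕜 F)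
    (hK : T.diff K ∈ holomorphicDifferentials 𝕜 F) :
    T.Represents (L + K)
      (SymmetricAlgebra.ι 𝕜 (holomorphicDifferentials 𝕜 F) ⟨T.diff L, hL⟩ *
        SymmetricAlgebra.ι 𝕜 (holomorphicDifferentials 𝕜 F) ⟨T.diff K, hK⟩) := by
  constructor
  · rw [Sym2H, sq]
    exact Submodule.mul_mem_mul ⟨_, rfl⟩ ⟨_, rfl⟩
  · rw [map_mul, canonicalMap_ι_diff, canonicalMap_ι_diff, quadDiff, monom_add,
      smul_mul_smul_comm, sq]

lemma G_mem_Sym2H (hW : ∀ u ∈ T.terms v i, T.Represents u (W u)) : T.G v i W ∈ Sym2H 𝕜 F := by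
  have hγ : ∀ ν ≤ T.n i, W (T.gamma v i ν) ∈ Sym2H 𝕜 F := fun ν hν =>
    (hW _ (.inl ⟨ν, hν, rfl⟩)).1
  exact sub_mem
    (add_mem (hγ 0 (Nat.zero_le _))
      (sum_mem fun ν hν => Submodule.smul_mem _ _ (hγ ν (Finset.mem_Icc.mp hν).2)))
    (sum_mem fun l hl => Submodule.smul_mem _ _ (hW _ (.inr ⟨l, hl, rfl⟩)).1)

lemma monom_gamma_add_sum (i : Fin k) (v : Fin (k + 1) → ℕ) :
    monom T.f (T.gamma v i 0) +
        ∑ ν ∈ Finset.Icc 1 (T.n i), T.a i (T.n i - ν) • monom T.f (T.gamma v i ν) =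
      ∑ l ∈ (T.d i).support, T.d i l • monom T.f (beta v l) := by
  have hreflect : ∑ ν ∈ Finset.Icc 1 (T.n i), T.a i (T.n i - ν) • monom T.f (T.gamma v i ν) =
      ∑ j ∈ Finset.range (T.n i), T.a i j • monom T.f (v + Pi.single i.succ (p ^ j)) := by
    have h := Finset.sum_Ico_reflect
      (fun j => T.a i j • monom T.f (v + Pi.single i.succ (p ^ j))) 1 (le_refl (T.n i + 1))
    rwa [Finset.Ico_add_one_right_eq_Icc, Nat.sub_self, Nat.add_sub_cancel,
      ← Finset.range_eq_Ico] at h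
  rw [hreflect]
  exact T.monom_add_sum_smul_monom_eq i v

lemma quadDiff_gamma_add_sum (i : Fin k) (v : Fin (k + 1) → ℕ) :
    T.quadDiff (T.gamma v i 0) +
        ∑ ν ∈ Finset.Icc 1 (T.n i), T.a i (T.n i - ν) • T.quadDiff (T.gamma v i ν) =
      ∑ l ∈ (T.d i).support, T.d i l • T.quadDiff (beta v l) := by
  have h := congrArg (· • dd 𝕜 (T.f 0) ^ 2) (T.monom_gamma_add_sum i v)
  simp only [add_smul, Finset.sum_smul, smul_assoc] at h
  exact h

variable [hp : Fact p.Prime]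

lemma lambdas_eq_support (i : Fin k) : T.lambdas i = (T.d i).support := by
  refine Finset.filter_true_of_mem fun l hl => ?_
  have hle := valuation_le_valuation_linearCombination
    (T.injOn_valuation_monom.mono (T.support_d_subset i)) (T.linearCombination_d_ne_zero i) hl
  rw [valuation_monom, valuation_linearCombination_d] at hle
  exact (pow_le_pow_iff_right₀ T.one_lt_γ).mp hle

lemma G_mem_canonicalIdeal (hW : ∀ u ∈ T.terms v i, T.Represents u (W u)) :
    T.G v i W ∈ canonicalIdeal 𝕜 F := by
  have hγ : ∀ ν ≤ T.n i, canonicalMap 𝕜 F (W (T.gamma v i ν)) = T.quadDiff (T.gamma v i ν) :=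
    fun ν hν => (hW _ (.inl ⟨ν, hν, rfl⟩)).2
  have hβ : ∀ l ∈ T.lambdas i, canonicalMap 𝕜 F (W (beta v l)) = T.quadDiff (beta v l) :=
    fun l hl => (hW _ (.inr ⟨l, hl, rfl⟩)).2
  rw [canonicalIdeal, RingHom.mem_ker, G, map_sub, map_add, map_sum, map_sum, sub_eq_zero,
    hγ 0 (Nat.zero_le _)]
  calc _ = T.quadDiff (T.gamma v i 0) +
        ∑ ν ∈ Finset.Icc 1 (T.n i), T.a i (T.n i - ν) • T.quadDiff (T.gamma v i ν) :=
      congrArg _ (Finset.sum_congr rfl fun ν hν => by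
        rw [map_smul, hγ ν (Finset.mem_Icc.mp hν).2])
    _ = ∑ l ∈ T.lambdas i, T.d i l • T.quadDiff (beta v l) := by
      rw [quadDiff_gamma_add_sum, lambdas_eq_support]
    _ = _ := Finset.sum_congr rfl fun l hl => by rw [map_smul, hβ l hl]

lemma nrm_le_of_mem_terms {u : Fin (k + 1) → ℕ} (hu : u ∈ T.terms v i) :
    T.nrm u ≤ T.nrm (T.gamma v i 0) := by
  simp only [nrm, gamma, wnorm_add, wnorm_single, Nat.sub_zero]
  rcases hu with ⟨ν, -, rfl⟩ | ⟨l, hl, rfl⟩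
  · rw [gamma, wnorm_add, wnorm_single]
    gcongr
    · exact hp.out.one_le
    · exact Nat.sub_le _ _
  · rw [beta, wnorm_add, add_comm]
    exact Nat.add_le_add_left (Finset.mem_filter.mp hl).2 _

end Tower

end HKG

end

theorem proposition4p4_general {p k : ℕ} [Fact p.Prime] {𝕜 F : Type*} [Field 𝕜]
    [CharP 𝕜 p] [Field F] [Algebra 𝕜 F] (T : HKG.Tower p k 𝕜 F) :
    (∃ hA : ∀ L ∈ T.A, T.diff L ∈ HKG.holomorphicDifferentials 𝕜 F,
      ∀ (L K : Fin (k + 1) → ℕ) (hL : L ∈ T.A) (hK : K ∈ T.A),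
        T.Represents (L + K)
          (SymmetricAlgebra.ι 𝕜 (HKG.holomorphicDifferentials 𝕜 F) ⟨T.diff L, hA L hL⟩ *
            SymmetricAlgebra.ι 𝕜 (HKG.holomorphicDifferentials 𝕜 F) ⟨T.diff K, hA K hK⟩)) ∧
    ∀ (i : Fin k) (v : Fin (k + 1) → ℕ), T.nrm (T.gamma v i 0) + 4 ≤ 4 * HKG.genus 𝕜 F →
      (∀ u ∈ T.terms v i, T.nrm u + 4 ≤ 4 * HKG.genus 𝕜 F ∧
        T.quadDiff u ∈ HKG.holomorphicQuadraticDifferentials 𝕜 F) ∧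
      ∀ W : (Fin (k + 1) → ℕ) → HKG.SymH 𝕜 F, (∀ u ∈ T.terms v i, T.Represents u (W u)) →
        T.G v i W ∈ HKG.Sym2H 𝕜 F ∧ T.G v i W ∈ HKG.canonicalIdeal 𝕜 F := by
  have hg := T.two_mul_genus_le
  have hA : ∀ L ∈ T.A, T.diff L ∈ HKG.holomorphicDifferentials 𝕜 F := fun L hL => by
    have hL' : T.nrm L + 2 ≤ 2 * HKG.genus 𝕜 F := hL
    exact T.diff_mem_holomorphicDifferentials (by omega)
  refine ⟨⟨hA, fun L K hL hK => T.represents_mul (hA L hL) (hA K hK)⟩, fun i v hv =>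
    ⟨fun u hu => ?_, fun W hW => ⟨T.G_mem_Sym2H hW, T.G_mem_canonicalIdeal hW⟩⟩⟩
  have hle := T.nrm_le_of_mem_terms hu
  exact ⟨by omega, T.quadDiff_mem_holomorphicQuadraticDifferentials (by omega)⟩

theorem proposition4p4 {p k : ℕ} [Fact p.Prime] {𝕜 F : Type*} [Field 𝕜] [IsAlgClosed 𝕜]
    [CharP 𝕜 p] [Field F] [Algebra 𝕜 F] (T : HKG.Tower p k 𝕜 F) :
    -- the differentials `ω_L = f_L df₀`, `L ∈ 𝐀`, are holomorphic, and `ω_L ω_K` represents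
    -- the quadratic differential `f_{L+K} df₀^{⊗ 2}`
    (∃ hA : ∀ L ∈ T.A, T.diff L ∈ HKG.holomorphicDifferentials 𝕜 F,
      ∀ (L K : Fin (k + 1) → ℕ) (hL : L ∈ T.A) (hK : K ∈ T.A),
        T.Represents (L + K)
          (SymmetricAlgebra.ι 𝕜 (HKG.holomorphicDifferentials 𝕜 F) ⟨T.diff L, hA L hL⟩ *
            SymmetricAlgebra.ι 𝕜 (HKG.holomorphicDifferentials 𝕜 F) ⟨T.diff K, hA K hK⟩)) ∧
    ∀ (i : Fin k) (v : Fin (k + 1) → ℕ), T.nrm (T.gamma v i 0) + 4 ≤ 4 * HKG.genus 𝕜 F →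
      -- each term is a holomorphic quadratic differential
      (∀ u ∈ T.terms v i, T.nrm u + 4 ≤ 4 * HKG.genus 𝕜 F ∧
        T.quadDiff u ∈ HKG.holomorphicQuadraticDifferentials 𝕜 F) ∧
      -- whatever the representatives of the terms, `G_{v,i}` is a quadratic element of the
      -- canonical ideal
      ∀ W : (Fin (k + 1) → ℕ) → HKG.SymH 𝕜 F, (∀ u ∈ T.terms v i, T.Represents u (W u)) →
        T.G v i W ∈ HKG.Sym2H 𝕜 F ∧ T.G v i W ∈ HKG.canonicalIdeal 𝕜 F :=
  proposition4p4_general T
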